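/- **The Kind Choice Theorem** (for the librationist theory of sorts). *Language.* Terms and formulas are generated simultaneously: noemata $v_0,v_1,\dots$ (variables, free occurrences of which serve as names), the constants $\mathrm T$ (truth) and € (the enumerator) are terms; if $a,b$ are terms, $\downarrow\! ab$ is a term and $a\in b$ a formula; if $A,B$ are formulas, $\downarrow\! AB$, $\forall v_nA$ are formulas and $\{v_n|A\}$ is a term. A term without free noemata is a *cognomen*. The connectives are defined from the joint $\downarrow$ ("neither–nor"), and $a=b$ is $\forall u(a\in u\to b\in u)$; $\mathbb T A$ is $\exists y(y\in\{y|A\})$ with $y$ not free in $A$; $\mathit{KIND}(a)$ is $\forall x(\mathbb T\,x\in a\vee\mathbb T\,x\notin a)$. Numerals are $\ulcorner 0\urcorner=\{x|x\ne x\}$, $\ulcorner n+1\urcorner=\{x|x\in\ulcorner n\urcorner\vee x=\ulcorner n\urcorner\}$; $\mathbb N=\{x|\forall y(\ulcorner 0\urcorner\in y\wedge\forall z(z\in y\to z\cup\{z\}\in y)\to x\in y)\}$, where $z\cup\{z\}$ is $\{w|w\in z\vee w=z\}$; pairs are Kuratowski pairs. Each expression has a natural number as its size: it is written in Polish notation (with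 $\hat{}\,yA$ for $\{y|A\}$ and $ba$ for $a\in b$) in the signs $\hat{}\,,\forall,\downarrow,\mathrm T,$ €$,v_0,v_1,\dots$, which are in this order the binary numerals $1,10,100,\dots$, and the numerals are concatenated; $\ulcorner A\urcorner$ is the numeral of the size of $A$. Let $e_0,e_1,\dots$ be any list of all cognomina, each once, in nondecreasing order of size. *Semantics.* By recursion on the ordinal $\alpha$ one defines which formulas hold at $\alpha$, free noemata standing at $\alpha$ for the cognomina that they name there. Here $a,b,c$ are cognomina and $B$ has at most $u$ free. $a\in\{u|B\}$ holds at $\alpha$ iff for some $\beta<\alpha$, $B(a/u)$ holds at all $\gamma$ with $\beta\le\gamma<\alpha$; $a\in\,\downarrow\! bc$ iff neither $a\in b$ nor $a\in c$ holds; $\downarrow\! AB$ iff neither $A$ nor $B$ holds; $\forall yA$ iff $A(c/y)$ holds for all $c$. Cognomina are identical at $\alpha$ iff they belong at $\alpha$ to the same cognomina of the form $\{u|B\}$ (this turns out to be what the formula $a=b$ says at $\alpha$). $v_0$ names $e_0$ at $\alpha$; $v_{n+1}$ names $e_{n+1}$ if this is identical at $\alpha$ with nothing named by $v_0,\dots,v_n$,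 and otherwise names what $v_n$ names. $a\in\mathrm T$ holds at $\alpha$ iff for some formula $A$, $a$ is identical with $\ulcorner A\urcorner$ and $\mathbb T A$ holds; $a\in$ € iff for some $n$ and $c$, $a$ is identical with $\langle\ulcorner n\urcorner,c\rangle$ and $c$ with what $v_n$ names. Let $\models_\gamma$ be the set of formulas $A$ for which $\mathbb T A$ holds at $\gamma$, $\mathit{IN}$ the set of those $A$ that are in $\models_\gamma$ for all sufficiently large $\gamma$, $\mathit{OUT}$ the set of those that are outside $\models_\gamma$ for all sufficiently large $\gamma$, and $\mathit{UNSTAB}$ the set of all other formulas. A limit ordinal $\kappa$ is *stabilizing* iff $\mathit{IN}\subseteq\ \models_\gamma\ \subseteq\mathit{IN}\cup\mathit{UNSTAB}$ for all $\gamma\ge\kappa$ and $\models_\kappa\ \subseteq\mathit{IN}$. A formula $A$ is a *maxim* iff $\mathbb T A$ holds at the least stabilizing ordinal. A term $a$ is a *kind* iff $\mathit{KIND}(a)$ is a maxim. *Order.* $a\blacktriangleleft b$ is $\exists x,y(x\in\mathbb N\wedge y\in\mathbb N\wedge\langle x,a\rangle\in$ € $\wedge\,\langle y,b\rangle\in$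 € $\wedge\, x\in y)$, where $x\in y$ is the usual strict order of the von Neumann numbers, and $a\trianglelefteq b$ is $a\blacktriangleleft b\vee a=b$. Say that $x$ is *least in* $y$ for the formula $x\in y\wedge\forall z(z\in y\to x\trianglelefteq z)$. *Theorem.* Let $a$ be a term that is a kind, all of whose members are kinds (that is, $\mathit{KIND}(a)$ and $\forall y(y\in a\to\mathit{KIND}(y))$ are maxims), and let $$C=\{x\mid\exists y(y\in a\wedge x\in y\wedge\forall z(z\in y\to x\trianglelefteq z))\}.$$ Then $C$ is a kind that picks precisely one member from each nonempty member of $a$. That is, $\mathit{KIND}(C)$ is a maxim, and the following are maxims: 1. for all $x$: $x\in C$ iff $x$ is least in some $y\in a$; 2. for every $y\in a$ with a member, there is precisely one (up to $=$) $x$ that is least in $y$, and this $x$ belongs to $C$; 3. for every $y\in a$ with a member, if $y$ is coextensional with every member of $a$ with which it has a common member, then precisely one $x$ belongs to both $y$ and $C$. -/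

import Mathlib

noncomputable section

namespace Libra

/-! ### Syntax

Noemata are `v n` with `n : ℕ`; the bare sign of `v n` is a bar followed by `n + 5` dots.
`mem a b` is the atomic formula with the meaning "a is a member of b", written `ba` in Polish form. -/

mutual
/-- Terms. -/
inductive Tm : Type
  /-- the noema `v n` -/
  | v : ℕ → Tm
  /-- the alethizor (truth) -/
  | T : Tm
  /-- the enumerator -/
  | E : Tm
  /-- the joint of two terms, as a juncture -/
  | nor : Tm → Tm → Tm
  /-- the abstract `{v n | A}` -/
  | compr : ℕ → Fm → Tm
/-- Formulas. -/
inductive Fm : Type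
  /-- `mem a b` is `a ∈ b` -/
  | mem : Tm → Tm → Fm
  /-- the joint of two formulas, as a connective -/
  | nor : Fm → Fm → Fm
  /-- `∀ v n, A` -/
  | all : ℕ → Fm → Fm
end

mutual
/-- The noemata present (free) in a term. -/
def Tm.noemata : Tm → Finset ℕ
  | .v n => {n}
  | .T => ∅
  | .E => ∅
  | .nor a b => a.noemata ∪ b.noemata
  | .compr n A => A.noemata.erase n
/-- The noemata present (free) in a formula. -/
def Fm.noemata : Fm → Finset ℕ
  | .mem a b => b.noemata ∪ a.noemata
  | .nor A B => A.noemata ∪ B.noemata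
  | .all n A => A.noemata.erase n
end

/-- Cognomina are the terms in which no noema is present. -/
def Tm.IsCognomen (a : Tm) : Prop := a.noemata = ∅

mutual
/-- Simultaneous substitution of `σ n` for the free occurrences of each noema `v n`. -/
def Tm.subst : Tm → (ℕ → Tm) → Tm
  | .v n, σ => σ n
  | .T, _ => .T
  | .E, _ => .E
  | .nor a b, σ => .nor (a.subst σ) (b.subst σ)
  | .compr n A, σ => .compr n (A.subst (Function.update σ n (.v n)))
/-- Simultaneous substitution of `σ n` for the free occurrences of each noema `v n`. -/
def Fm.subst : Fm → (ℕ → Tm) → Fm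
  | .mem a b, σ => .mem (a.subst σ) (b.subst σ)
  | .nor A B, σ => .nor (A.subst σ) (B.subst σ)
  | .all n A, σ => .all n (A.subst (Function.update σ n (.v n)))
end

/-- `A(a/u)`: substitution of the term `a` for the noema `v u` in `A`. -/
def Fm.subst1 (A : Fm) (u : ℕ) (a : Tm) : Fm := A.subst (Function.update Tm.v u a)

/-! ### Expressions as natural numbers

The bare sign "bar followed by `n` dots" is the number `2 ^ n`, and juxtaposition is the
concatenation of binary numerals. -/

/-- Concatenation of binary numerals. -/
def cat (m n : ℕ) : ℕ := m * 2 ^ Nat.size n + n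

mutual
/-- The number that a term is. -/
def Tm.size : Tm → ℕ
  | .v n => 2 ^ (n + 5)
  | .T => 2 ^ 3
  | .E => 2 ^ 4
  | .nor a b => cat (2 ^ 2) (cat a.size b.size)
  | .compr n A => cat (2 ^ 0) (cat (2 ^ (n + 5)) A.size)
/-- The number that a formula is. -/
def Fm.size : Fm → ℕ
  | .mem a b => cat b.size a.size
  | .nor A B => cat (2 ^ 2) (cat A.size B.size)
  | .all n A => cat (2 ^ 1) (cat (2 ^ (n + 5)) A.size)
end

/-- `e` lists the cognomina, each once, in the order of their sizes as natural numbers.  (The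
Polish notation is not uniquely readable, so different terms may have the same size; the order
among these is left open.) -/
structure IsEnumeration (e : ℕ → Tm) : Prop where
  isCognomen : ∀ n, (e n).IsCognomen
  injective : Function.Injective e
  surjective : ∀ a : Tm, a.IsCognomen → ∃ n, e n = a
  mono : ∀ m n, m ≤ n → (e m).size ≤ (e n).size

/-! Such enumerations exist. -/

theorem cat_pos {m n : ℕ} (hn : 0 < n) : 0 < cat m n := by unfold cat; omega
theorem le_cat_left {m n : ℕ} (hn : 0 < n) : m < cat m n := by
  unfold cat; have : m * 1 ≤ m * 2 ^ n.size := Nat.mul_le_mul_left _ Nat.one_le_two_pow; omega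
theorem le_cat_right {m n : ℕ} (hm : 0 < m) : n < cat m n := by
  unfold cat; have : 0 < m * 2 ^ n.size := by positivity
  omega

mutual
theorem Tm.size_pos : ∀ a : Tm, 0 < a.size
  | .v n => by simp [Tm.size]
  | .T => by simp [Tm.size]
  | .E => by simp [Tm.size]
  | .nor _ b => cat_pos (cat_pos b.size_pos)
  | .compr _ A => cat_pos (cat_pos A.size_pos)
theorem Fm.size_pos : ∀ A : Fm, 0 < A.size
  | .mem a _ => cat_pos a.size_pos
  | .nor _ B => cat_pos (cat_pos B.size_pos)
  | .all _ A => cat_pos (cat_pos A.size_pos)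
end

theorem finite_size (N : ℕ) : {a : Tm | a.size < N}.Finite ∧ {A : Fm | A.size < N}.Finite := by
  induction N with
  | zero => simp
  | succ N ih =>
    obtain ⟨h1, h2⟩ := ih
    have h3 := Set.finite_lt_nat N
    constructor
    · refine ((((h3.image Tm.v).union (Set.toFinite {Tm.T, Tm.E})).union
        (h1.image2 Tm.nor h1)).union (h3.image2 Tm.compr h2)).subset ?_
      rintro (n | _ | _ | ⟨a, b⟩ | ⟨n, A⟩) ha
      · left; left; left
        refine ⟨n, ?_, rfl⟩
        have : n + 5 < 2 ^ (n + 5) := Nat.lt_two_pow_self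
        simp [Tm.size] at ha ⊢; omega
      · simp
      · simp
      · left; right
        simp only [Set.mem_ofPred_eq, Tm.size] at ha
        have k1 := le_cat_right (m := 2 ^ 2) (n := cat a.size b.size) (by norm_num)
        have k2 := le_cat_left (m := a.size) b.size_pos
        have k3 := le_cat_right (n := b.size) a.size_pos
        exact ⟨a, by simp; omega, b, by simp; omega, rfl⟩
      · right
        simp only [Set.mem_ofPred_eq, Tm.size] at ha
        have k1 := le_cat_right (m := 2 ^ 0) (n := cat (2 ^ (n + 5)) A.size) (by norm_num)
        have k2 := le_cat_left (m := 2 ^ (n + 5)) A.size_pos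
        have k3 := le_cat_right (m := 2 ^ (n + 5)) (n := A.size) (by positivity)
        have : n + 5 < 2 ^ (n + 5) := Nat.lt_two_pow_self
        exact ⟨n, by simp; omega, A, by simp; omega, rfl⟩
    · refine (((h1.image2 Fm.mem h1).union (h2.image2 Fm.nor h2)).union
        (h3.image2 Fm.all h2)).subset ?_
      rintro (⟨a, b⟩ | ⟨a, b⟩ | ⟨n, A⟩) ha
      · left; left
        simp only [Set.mem_ofPred_eq, Fm.size] at ha
        have k2 := le_cat_left (m := b.size) a.size_pos
        have k3 := le_cat_right (n := a.size) b.size_pos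
        exact ⟨a, by simp; omega, b, by simp; omega, rfl⟩
      · left; right
        simp only [Set.mem_ofPred_eq, Fm.size] at ha
        have k1 := le_cat_right (m := 2 ^ 2) (n := cat a.size b.size) (by norm_num)
        have k2 := le_cat_left (m := a.size) b.size_pos
        have k3 := le_cat_right (n := b.size) a.size_pos
        exact ⟨a, by simp; omega, b, by simp; omega, rfl⟩
      · right
        simp only [Set.mem_ofPred_eq, Fm.size] at ha
        have k1 := le_cat_right (m := 2 ^ 1) (n := cat (2 ^ (n + 5)) A.size) (by norm_num)
        have k2 := le_cat_left (m := 2 ^ (n + 5)) A.size_pos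
        have k3 := le_cat_right (m := 2 ^ (n + 5)) (n := A.size) (by positivity)
        have : n + 5 < 2 ^ (n + 5) := Nat.lt_two_pow_self
        exact ⟨n, by simp; omega, A, by simp; omega, rfl⟩

theorem exists_isEnumeration : ∃ e : ℕ → Tm, IsEnumeration e := by
  have hc : Countable Tm := by
    rw [← Set.countable_univ_iff]
    refine (Set.countable_iUnion fun N => (finite_size N).1.countable).mono ?_
    intro a _
    exact Set.mem_iUnion.2 ⟨a.size + 1, Nat.lt_succ_self _⟩
  obtain ⟨g, hg⟩ := exists_injective_nat Tm
  let lt : Tm → Tm → Prop := fun a b => a.size < b.size ∨ (a.size = b.size ∧ g a < g b)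
  have hfin : ∀ b, {a | lt a b}.Finite := fun b =>
    (finite_size (b.size + 1)).1.subset fun a ha => by
      simp only [Set.mem_ofPred_eq, lt] at ha ⊢; omega
  let h : Tm → ℕ := fun b => {a | lt a b}.ncard
  have hlt : ∀ a b, lt a b → h a < h b := fun a b hab =>
    Set.ncard_lt_ncard ⟨fun c hc => by simp only [Set.mem_ofPred_eq, lt] at *; omega,
      fun hs => by have := hs (a := a) hab; simp [lt] at this⟩ (hfin b)
  have hinj : Function.Injective h := fun a b hab => by
    by_contra hne
    have hgne : g a ≠ g b := fun hgg => hne (hg hgg)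
    have : lt a b ∨ lt b a := by simp only [lt]; omega
    rcases this with k | k <;> [have := hlt _ _ k; have := hlt _ _ k] <;> omega
  let S : Set ℕ := h '' {a | a.IsCognomen}
  have hS : S.Infinite := by
    refine Set.Infinite.image hinj.injOn ?_
    refine Set.infinite_of_injective_forall_mem (f := fun n : ℕ => Tm.compr n (.mem .T .T)) ?_ ?_
    · intro m n hmn; simpa using hmn
    · intro n; simp [Tm.IsCognomen, Tm.noemata, Fm.noemata]
  have := hS.to_subtype
  classical
  let o := Nat.Subtype.orderIsoOfNat S
  have ho : ∀ n, ∃ a : Tm, a.IsCognomen ∧ h a = o n := fun n => (o n).2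
  choose e he1 he2 using ho
  refine ⟨e, he1, ?_, ?_, ?_⟩
  · intro m n hmn
    have : (o m : ℕ) = o n := by rw [← he2, ← he2, hmn]
    exact o.injective (Subtype.ext this)
  · intro a ha
    obtain ⟨n, hn⟩ := o.surjective ⟨h a, a, ha, rfl⟩
    exact ⟨n, hinj (by rw [he2, hn])⟩
  · intro m n hmn
    by_contra hlt'
    have h1 := hlt (e n) (e m) (Or.inl (by omega))
    rw [he2, he2] at h1
    have h2 : o m ≤ o n := o.monotone hmn
    have h3 : (o m : ℕ) ≤ o n := h2
    omega
/-! ### Defined connectives, identity, numerals, pairs -/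

/-- The least noema (index) outside `s`; used to pick bound variables. -/
def fresh (s : Finset ℕ) : ℕ := sInf {n | n ∉ s}

/-- An index above all indices in `s` (and at least `2`); used to pick bound variables. -/
def above (s : Finset ℕ) : ℕ := s.sup id + 2

namespace Fm

def neg (A : Fm) : Fm := nor A A
def or (A B : Fm) : Fm := nor (nor A B) (nor A B)
def and (A B : Fm) : Fm := nor (nor A A) (nor B B)
def imp (A B : Fm) : Fm := nor (nor (nor A A) B) (nor (nor A A) B)
def iff (A B : Fm) : Fm := and (imp A B) (imp B A)
def ex (n : ℕ) (A : Fm) : Fm := neg (all n (neg A))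

/-- Leibnizian-Russellian identity `a = b`, that is `∀ u (a ∈ u → b ∈ u)`. -/
def eq (a b : Tm) : Fm :=
  let u := fresh (a.noemata ∪ b.noemata)
  all u (imp (mem a (.v u)) (mem b (.v u)))

/-- The truth operator `𝕋 A`, that is `∃ y (y ∈ {y | A})` with `y` the first noema not in `A`. -/
def tr (A : Fm) : Fm :=
  let y := fresh A.noemata
  ex y (mem (.v y) (.compr y A))

/-- `KIND(a)`, that is `∀ x (𝕋 x ∈ a ∨ 𝕋 x ∉ a)`. -/
def kind (a : Tm) : Fm :=
  let x := fresh a.noemata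
  all x (or (tr (mem (.v x) a)) (tr (neg (mem (.v x) a))))

end Fm

namespace Tm

/-- `{x | x ≠ x}`. -/
def zero : Tm := compr 0 (Fm.neg (Fm.eq (v 0) (v 0)))

/-- `{x | x ∈ a ∨ x = a}`. -/
def succ (a : Tm) : Tm :=
  let x := fresh a.noemata
  compr x (Fm.or (Fm.mem (v x) a) (Fm.eq (v x) a))

/-- The numeral of `n`.  The Gödel code of a formula `A` is `numeral A.size`. -/
def numeral : ℕ → Tm
  | 0 => zero
  | n + 1 => succ (numeral n)

/-- `{a}` -/
def sing (a : Tm) : Tm :=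
  let y := fresh a.noemata
  compr y (Fm.eq (v y) a)

/-- `{a, b}` -/
def upair (a b : Tm) : Tm :=
  let y := fresh (a.noemata ∪ b.noemata)
  compr y (Fm.or (Fm.eq (v y) a) (Fm.eq (v y) b))

/-- The Kuratowski pair `{{a}, {a, b}}`. -/
def pair (a b : Tm) : Tm := upair (sing a) (upair a b)

/-- The natural numbers: `{x | ∀ y (0 ∈ y ∧ ∀ z (z ∈ y → z' ∈ y) → x ∈ y)}`. -/
def nat : Tm :=
  compr 0 (Fm.all 1 (Fm.imp
    (Fm.and (Fm.mem zero (v 1))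
      (Fm.all 2 (Fm.imp (Fm.mem (v 2) (v 1)) (Fm.mem (succ (v 2)) (v 1)))))
    (Fm.mem (v 0) (v 1))))

end Tm

/-! ### The semantical process

At each stage a predicate `near` on propositions is given, `near A` meaning that `A` has held from
some earlier stage on, below the present one.  Noemata name cognomina at each stage (`name`). -/

/-- Identity of cognomina at the stage: they belong to the same abstracts.  Since truth, the
enumerator and the joints cannot separate cognomina that the abstracts do not separate, this is
what the formula `a = b` says at the stage (`holds_eq` below). -/
def Ident (near : Fm → Prop) (a b : Tm) : Prop :=
  ∀ (u : ℕ) (A : Fm), (Tm.compr u A).IsCognomen → (near (A.subst1 u a) ↔ near (A.subst1 u b))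

open Classical in
/-- The cognomen that `v n` names: the `n`-th one if it differs from what the earlier noemata
name, and otherwise the one that the preceding noema names. -/
def name (e : ℕ → Tm) (near : Fm → Prop) : ℕ → Tm
  | 0 => e 0
  | n + 1 =>
    if ∃ m : Fin (n + 1), Ident near (name e near m) (e (n + 1)) then name e near n
    else e (n + 1)

/-- Membership of the cognomen `a` in a cognomen (the case of a noema does not arise). -/
def Member (e : ℕ → Tm) (near : Fm → Prop) (a : Tm) : Tm → Prop
  | .v _ => False
  | .T => ∃ A : Fm, Ident near a (.numeral A.size) ∧ near (A.subst (name e near))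
  | .E => ∃ (c : Tm) (n : ℕ), c.IsCognomen ∧ Ident near a (.pair (.numeral n) c) ∧
      Ident near c (name e near n)
  | .nor b c => ¬ Member e near a b ∧ ¬ Member e near a c
  | .compr u A => near (A.subst1 u a)

/-- Truth at the stage of a formula whose free noemata stand for the cognomina `σ n`. -/
def Holds (e : ℕ → Tm) (near : Fm → Prop) : Fm → (ℕ → Tm) → Prop
  | .mem a b, σ => Member e near (a.subst σ) (b.subst σ)
  | .nor A B, σ => ¬ Holds e near A σ ∧ ¬ Holds e near B σ
  | .all n A, σ => ∀ c : Tm, c.IsCognomen → Holds e near A (Function.update σ n c)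

theorem fresh_notMem (s : Finset ℕ) : fresh s ∉ s :=
  Nat.sInf_mem (s := {n | n ∉ s}) (Infinite.exists_notMem_finset s)

mutual
theorem Tm.subst_congr : ∀ (a : Tm) (σ τ : ℕ → Tm), (∀ n ∈ a.noemata, σ n = τ n) →
    a.subst σ = a.subst τ
  | .v n, σ, τ, h => by simpa [Tm.subst, Tm.noemata] using h
  | .T, _, _, _ => rfl
  | .E, _, _, _ => rfl
  | .nor a b, σ, τ, h => by
    simp only [Tm.noemata, Finset.mem_union] at h
    simp only [Tm.subst]
    rw [Tm.subst_congr a σ τ fun n hn => h n (Or.inl hn),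
      Tm.subst_congr b σ τ fun n hn => h n (Or.inr hn)]
  | .compr m A, σ, τ, h => by
    simp only [Tm.noemata, Finset.mem_erase] at h
    simp only [Tm.subst]
    rw [Fm.subst_congr A _ _ fun n hn => ?_]
    by_cases hm : n = m
    · subst hm; simp
    · simpa [Function.update_of_ne hm] using h n ⟨hm, hn⟩
theorem Fm.subst_congr : ∀ (A : Fm) (σ τ : ℕ → Tm), (∀ n ∈ A.noemata, σ n = τ n) →
    A.subst σ = A.subst τ
  | .mem a b, σ, τ, h => by
    simp only [Fm.noemata, Finset.mem_union] at h
    simp only [Fm.subst]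
    rw [Tm.subst_congr a σ τ fun n hn => h n (Or.inr hn),
      Tm.subst_congr b σ τ fun n hn => h n (Or.inl hn)]
  | .nor a b, σ, τ, h => by
    simp only [Fm.noemata, Finset.mem_union] at h
    simp only [Fm.subst]
    rw [Fm.subst_congr a σ τ fun n hn => h n (Or.inl hn),
      Fm.subst_congr b σ τ fun n hn => h n (Or.inr hn)]
  | .all m A, σ, τ, h => by
    simp only [Fm.noemata, Finset.mem_erase] at h
    simp only [Fm.subst]
    rw [Fm.subst_congr A _ _ fun n hn => ?_]
    by_cases hm : n = m
    · subst hm; simp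
    · simpa [Function.update_of_ne hm] using h n ⟨hm, hn⟩
end

theorem Tm.subst_update {a : Tm} {u : ℕ} (h : u ∉ a.noemata) (σ : ℕ → Tm) (c : Tm) :
    a.subst (Function.update σ u c) = a.subst σ :=
  Tm.subst_congr a _ _ fun n hn => Function.update_of_ne (by rintro rfl; exact h hn) _ _

theorem Ident.member {e : ℕ → Tm} {near : Fm → Prop} {a b : Tm} (h : Ident near a b) :
    ∀ c : Tm, c.IsCognomen → (Member e near a c ↔ Member e near b c)
  | .v n, _ => by simp [Member]
  | .T, _ => by simp only [Member, Ident] at h ⊢; grind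
  | .E, _ => by
    have key : ∀ c, Ident near a c ↔ Ident near b c := fun c =>
      ⟨fun k u A hA => (h u A hA).symm.trans (k u A hA), fun k u A hA => (h u A hA).trans (k u A hA)⟩
    simp only [Member, key]
  | .nor c d, hc => by
    simp only [Tm.IsCognomen, Tm.noemata, Finset.union_eq_empty] at hc
    simp only [Member, Ident.member h c hc.1, Ident.member h d hc.2]
  | .compr u A, hc => h u A hc

/-- At every stage, the formula `a = b` says that `a` and `b` belong to the same abstracts. -/
theorem holds_eq (e : ℕ → Tm) (near : Fm → Prop) (a b : Tm) (σ : ℕ → Tm) :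
    Holds e near (Fm.eq a b) σ ↔ Ident near (a.subst σ) (b.subst σ) := by
  have hf := fresh_notMem (a.noemata ∪ b.noemata)
  simp only [Finset.mem_union, not_or] at hf
  simp only [Fm.eq, Fm.imp, Holds, Tm.subst_update hf.1, Tm.subst_update hf.2, Tm.subst,
    Function.update_self]
  constructor
  · intro h u A hA
    have h1 := h (.compr u A) hA
    have h2 := h (.nor (.compr u A) (.compr u A)) (by
      simpa [Tm.IsCognomen, Tm.noemata] using hA)
    simp only [Member] at h1 h2
    tauto
  · intro h c hc
    have := h.member (e := e) c hc
    tauto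

/-- `Sat e α A`: the formula `A` holds at the ordinal `α`. -/
def Sat (e : ℕ → Tm) (α : Ordinal.{0}) (A : Fm) : Prop :=
  let near : Fm → Prop := fun B => ∃ β, β < α ∧ ∀ γ, ∀ _h : γ < α, β ≤ γ → Sat e γ B
  Holds e near A (name e near)
termination_by α

/-- The set of the formulas `A` such that `𝕋 A` holds at `γ`. -/
def trueAt (e : ℕ → Tm) (γ : Ordinal.{0}) : Set Fm := {A | Sat e γ (Fm.tr A)}

def stableIn (e : ℕ → Tm) : Set Fm := {A | ∃ β, ∀ γ, β ≤ γ → A ∈ trueAt e γ}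
def stableOut (e : ℕ → Tm) : Set Fm := {A | ∃ β, ∀ γ, β ≤ γ → A ∉ trueAt e γ}
def unstable (e : ℕ → Tm) : Set Fm := (stableIn e ∪ stableOut e)ᶜ

def Covers (e : ℕ → Tm) (κ : Ordinal.{0}) : Prop :=
  Order.IsSuccLimit κ ∧
    ∀ γ, κ ≤ γ → stableIn e ⊆ trueAt e γ ∧ trueAt e γ ⊆ stableIn e ∪ unstable e

def Stabilizes (e : ℕ → Tm) (σ : Ordinal.{0}) : Prop :=
  Covers e σ ∧ trueAt e σ ⊆ stableIn e

/-- The closure ordinal, i.e. the least stabilizing ordinal. -/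
def koppa (e : ℕ → Tm) : Ordinal.{0} := sInf {σ | Stabilizes e σ}

/-- `A` is a maxim: `𝕋 A` holds at the closure ordinal. -/
def Maxim (e : ℕ → Tm) (A : Fm) : Prop := Sat e (koppa e) (Fm.tr A)

/-! ### The order induced by the enumerator, and the choice term -/

namespace Fm

/-- The strict order: for some `x` and `y` in `ℕ`, `⟨x, a⟩` and `⟨y, b⟩` belong to the enumerator
and `x < y`, which for von Neumann numbers is `x ∈ y`. -/
def prec (a b : Tm) : Fm :=
  let x := above (a.noemata ∪ b.noemata)
  let y := x + 1
  ex x (ex y (and (mem (.v x) .nat) (and (mem (.v y) .nat)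
    (and (mem (.pair (.v x) a) .E) (and (mem (.pair (.v y) b) .E) (mem (.v x) (.v y)))))))

def preceq (a b : Tm) : Fm := or (prec a b) (eq a b)

/-- `x ∈ y ∧ ∀ z (z ∈ y → x ⊴ z)`. -/
def least (x y : Tm) : Fm :=
  let z := above (x.noemata ∪ y.noemata)
  and (mem x y) (all z (imp (mem (.v z) y) (preceq x (.v z))))

end Fm

/-- `{x | ∃ y (y ∈ a ∧ x ∈ y ∧ ∀ z (z ∈ y → x ⊴ z))}`. -/
def Tm.choice (a : Tm) : Tm :=
  let x := above a.noemata
  let y := x + 1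
  .compr x (.ex y (.and (.mem (.v y) a) (.least (.v x) (.v y))))

end Libra

end

/-!
The stages form a revision sequence: `c ∈ {u | A}` holds at a stage when `A(c/u)` has held from some
earlier stage on (`nearAt`).

Identity is the one notion that cannot oscillate.  The abstract `{u | u = b}` always contains `b`,
so whatever is identical with `b` now was so at earlier stages, cofinally; hence identities only get
lost as the stages advance (`Ident.antitone`).  They are settled from some stage on, and with them
what the noemata name, and a limit stage reached after sufficiently many failures of every formula
that is not stably true is stabilizing (`exists_stabilizes`).  From the closure ordinal `κ` on,
therefore, identity is a fixed relation `Same`, noemata name fixed cognomina `named`, and a formula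
is a maxim just in case it holds at all stages from `κ` on (`maxim_iff`).

The tool for computing beyond `κ` is `nearAt_iff_of_forall`: a condition whose truth value is
constant from `κ` on has that value in abstracts as well.  It gives the expected members of
singletons, pairs and numerals, so pairs are injective up to identity and `m ∈ n` for numerals is
`m < n`.  A pair in the enumerator consists of a numeral `n` and what `v n` names, so `x ⊴ y`
compares the indices of the first noemata that name `x` and `y` (`holds_preceq`); this uses that
the noemata naming a given cognomen form an interval (`same_named_of_le`).  The order is thus a
well-order up to identity, and it is the same at all stages from `κ` on.

A kind has the same members at all these stages.  When `a` and its members are kinds, "least in a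
member of `a`" has a constant truth value, so the choice term is a kind with the intended members
(`member_choice`), and the remaining claims follow from the well-ordering.

The given term may contain free noemata; it is then evaluated at the cognomina named from `κ` on.
Substitutions only ever put in cognomina, so that bound noemata are never renamed.
-/

namespace Libra

/-! ### Substitution -/

/-- An assignment of cognomina to the noemata. -/
def IsAssignment (σ : ℕ → Tm) : Prop := ∀ n, (σ n).IsCognomen

theorem IsAssignment.update {σ : ℕ → Tm} (hσ : IsAssignment σ) (u : ℕ) {c : Tm}
    (hc : c.IsCognomen) : IsAssignment (Function.update σ u c) := by
  intro n
  by_cases h : n = u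
  · subst h; simpa using hc
  · simpa [h] using hσ n

/-- Substitutions whose composition with any other substitution is computed without renaming
bound noemata: each noema is left alone or replaced by a cognomen. -/
def IsPartialAssignment (ρ : ℕ → Tm) : Prop := ∀ n, (ρ n).IsCognomen ∨ ρ n = .v n

theorem IsAssignment.isPartialAssignment {σ : ℕ → Tm} (hσ : IsAssignment σ) :
    IsPartialAssignment σ := fun n => Or.inl (hσ n)

theorem IsPartialAssignment.update {ρ : ℕ → Tm} (hρ : IsPartialAssignment ρ) (u : ℕ) :
    IsPartialAssignment (Function.update ρ u (.v u)) := by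
  intro n
  by_cases h : n = u
  · subst h; simp
  · simpa [h] using hρ n

mutual
theorem Tm.subst_v : ∀ a : Tm, a.subst Tm.v = a
  | .v _ => rfl
  | .T => rfl
  | .E => rfl
  | .nor a b => by rw [Tm.subst, Tm.subst_v a, Tm.subst_v b]
  | .compr u A => by rw [Tm.subst, Function.update_eq_self, Fm.subst_v A]
theorem Fm.subst_v : ∀ A : Fm, A.subst Tm.v = A
  | .mem a b => by rw [Fm.subst, Tm.subst_v a, Tm.subst_v b]
  | .nor A B => by rw [Fm.subst, Fm.subst_v A, Fm.subst_v B]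
  | .all u A => by rw [Fm.subst, Function.update_eq_self, Fm.subst_v A]
end

theorem Tm.IsCognomen.subst {a : Tm} (h : a.IsCognomen) (σ : ℕ → Tm) : a.subst σ = a := by
  conv_rhs => rw [← a.subst_v]
  exact a.subst_congr _ _ fun n hn => by
    rw [h] at hn; simp at hn

theorem IsPartialAssignment.update_comp {ρ : ℕ → Tm} (hρ : IsPartialAssignment ρ) (τ : ℕ → Tm)
    (u : ℕ) (c : Tm) :
    (fun m => (Function.update ρ u (.v u) m).subst (Function.update τ u c)) =
      Function.update (fun m => (ρ m).subst τ) u c := by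
  funext m
  by_cases h : m = u
  · subst h; simp [Tm.subst]
  · simp only [Function.update_of_ne h]
    rcases hρ m with h' | h'
    · rw [h'.subst, h'.subst]
    · simp [h', Tm.subst, h]

mutual
theorem Tm.subst_subst : ∀ (a : Tm) {ρ : ℕ → Tm} (_ : IsPartialAssignment ρ) (τ : ℕ → Tm),
    (a.subst ρ).subst τ = a.subst fun n => (ρ n).subst τ
  | .v _, _, _, _ => rfl
  | .T, _, _, _ => rfl
  | .E, _, _, _ => rfl
  | .nor a b, _, h, τ => by simp only [Tm.subst, a.subst_subst h, b.subst_subst h]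
  | .compr u A, _, h, τ => by
    simp only [Tm.subst, A.subst_subst (h.update u), h.update_comp]
theorem Fm.subst_subst : ∀ (A : Fm) {ρ : ℕ → Tm} (_ : IsPartialAssignment ρ) (τ : ℕ → Tm),
    (A.subst ρ).subst τ = A.subst fun n => (ρ n).subst τ
  | .mem a b, _, h, τ => by simp only [Fm.subst, a.subst_subst h, b.subst_subst h]
  | .nor A B, _, h, τ => by simp only [Fm.subst, A.subst_subst h, B.subst_subst h]
  | .all u A, _, h, τ => by
    simp only [Fm.subst, A.subst_subst (h.update u), h.update_comp]
end

theorem IsAssignment.comp {σ : ℕ → Tm} (hσ : IsAssignment σ) (τ : ℕ → Tm) :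
    (fun n => (σ n).subst τ) = σ := funext fun n => (hσ n).subst τ

/-- Instantiating the bound noema of an abstract after an assignment. -/
theorem Fm.subst_subst1 (A : Fm) {σ : ℕ → Tm} (hσ : IsAssignment σ) (u : ℕ) (c : Tm) :
    (A.subst (Function.update σ u (.v u))).subst1 u c = A.subst (Function.update σ u c) := by
  rw [Fm.subst1, A.subst_subst (hσ.isPartialAssignment.update u),
    hσ.isPartialAssignment.update_comp, hσ.comp]

mutual
theorem Tm.mem_noemata_of_subst : ∀ (a : Tm) {ρ : ℕ → Tm} (_ : IsPartialAssignment ρ) (n : ℕ),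
    n ∈ (a.subst ρ).noemata → n ∈ a.noemata ∧ ρ n = .v n
  | .v m, ρ, h, n => by
    intro hn
    simp only [Tm.subst] at hn
    rcases h m with h' | h'
    · rw [h'] at hn; simp at hn
    · rw [h'] at hn
      simp only [Tm.noemata, Finset.mem_singleton] at hn ⊢
      subst hn; exact ⟨rfl, h'⟩
  | .T, _, _, _ => by simp [Tm.subst, Tm.noemata]
  | .E, _, _, _ => by simp [Tm.subst, Tm.noemata]
  | .nor a b, _, h, n => by
    have := a.mem_noemata_of_subst h n
    have := b.mem_noemata_of_subst h n
    simp only [Tm.subst, Tm.noemata, Finset.mem_union]; tauto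
  | .compr u A, _, h, n => by
    have := A.mem_noemata_of_subst (h.update u) n
    simp only [Tm.subst, Tm.noemata, Finset.mem_erase]
    rintro ⟨h1, h2⟩
    simpa [h1] using this h2
theorem Fm.mem_noemata_of_subst : ∀ (A : Fm) {ρ : ℕ → Tm} (_ : IsPartialAssignment ρ) (n : ℕ),
    n ∈ (A.subst ρ).noemata → n ∈ A.noemata ∧ ρ n = .v n
  | .mem a b, _, h, n => by
    have := a.mem_noemata_of_subst h n
    have := b.mem_noemata_of_subst h n
    simp only [Fm.subst, Fm.noemata, Finset.mem_union]; tauto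
  | .nor A B, _, h, n => by
    have := A.mem_noemata_of_subst h n
    have := B.mem_noemata_of_subst h n
    simp only [Fm.subst, Fm.noemata, Finset.mem_union]; tauto
  | .all u A, _, h, n => by
    have := A.mem_noemata_of_subst (h.update u) n
    simp only [Fm.subst, Fm.noemata, Finset.mem_erase]
    rintro ⟨h1, h2⟩
    simpa [h1] using this h2
end

theorem IsAssignment.ne_v {σ : ℕ → Tm} (hσ : IsAssignment σ) (n : ℕ) : σ n ≠ .v n := by
  intro h
  have := hσ n
  simp [h, Tm.IsCognomen, Tm.noemata] at this

theorem IsAssignment.isCognomen_subst {σ : ℕ → Tm} (hσ : IsAssignment σ) (a : Tm) :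
    (a.subst σ).IsCognomen :=
  Finset.eq_empty_of_forall_notMem fun n hn =>
    hσ.ne_v n (a.mem_noemata_of_subst hσ.isPartialAssignment n hn).2

theorem Fm.subst_update {A : Fm} {u : ℕ} (h : u ∉ A.noemata) (σ : ℕ → Tm) (c : Tm) :
    A.subst (Function.update σ u c) = A.subst σ :=
  A.subst_congr _ _ fun _ hn => Function.update_of_ne (by rintro rfl; exact h hn) _ _

theorem isCognomen_T : Tm.T.IsCognomen := rfl

/-- A default assignment, for reading closed terms as instances of themselves. -/
def trivialAssignment : ℕ → Tm := fun _ => .T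

theorem isAssignment_trivial : IsAssignment trivialAssignment := fun _ => rfl

/-! ### Truth of compound formulas at a stage -/

section Truth

variable {e : ℕ → Tm} {near : Fm → Prop} {σ : ℕ → Tm}

theorem holds_neg {A : Fm} : Holds e near A.neg σ ↔ ¬ Holds e near A σ := by
  simp only [Fm.neg, Holds, and_self]
theorem holds_or {A B : Fm} :
    Holds e near (A.or B) σ ↔ Holds e near A σ ∨ Holds e near B σ := by
  simp only [Fm.or, Holds]; tauto
theorem holds_and {A B : Fm} :
    Holds e near (A.and B) σ ↔ Holds e near A σ ∧ Holds e near B σ := by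
  simp only [Fm.and, Holds]; tauto
theorem holds_imp {A B : Fm} :
    Holds e near (A.imp B) σ ↔ (Holds e near A σ → Holds e near B σ) := by
  simp only [Fm.imp, Holds]; tauto
theorem holds_iff {A B : Fm} :
    Holds e near (A.iff B) σ ↔ (Holds e near A σ ↔ Holds e near B σ) := by
  simp only [Fm.iff, holds_and, holds_imp]; tauto
theorem holds_all {n : ℕ} {A : Fm} : Holds e near (.all n A) σ ↔
    ∀ c : Tm, c.IsCognomen → Holds e near A (Function.update σ n c) := by simp only [Holds]
theorem holds_ex {n : ℕ} {A : Fm} : Holds e near (.ex n A) σ ↔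
    ∃ c : Tm, c.IsCognomen ∧ Holds e near A (Function.update σ n c) := by
  simp only [Fm.ex, holds_neg, holds_all]; push Not; rfl
theorem holds_mem {a b : Tm} : Holds e near (.mem a b) σ ↔
    Member e near (a.subst σ) (b.subst σ) := by simp only [Holds]

/-- Substituting cognomina first does not change what a formula says. -/
theorem holds_subst (near : Fm → Prop) (A : Fm) {ρ : ℕ → Tm} (hρ : IsPartialAssignment ρ)
    (τ : ℕ → Tm) :
    Holds e near (A.subst ρ) τ ↔ Holds e near A fun n => (ρ n).subst τ := by
  match A with
  | .mem a b => simp only [Fm.subst, holds_mem, Tm.subst_subst _ hρ]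
  | .nor A B => simp only [Fm.subst, Holds, holds_subst near A hρ, holds_subst near B hρ]
  | .all u A =>
    simp only [Fm.subst, holds_all, holds_subst near A (hρ.update u), hρ.update_comp]

theorem member_compr_subst (hσ : IsAssignment σ) (c : Tm) (u : ℕ) (A : Fm) :
    Member e near c ((Tm.compr u A).subst σ) ↔ near (A.subst (Function.update σ u c)) := by
  simp only [Tm.subst, Member, A.subst_subst1 hσ]

theorem holds_tr (hσ : IsAssignment σ) (A : Fm) : Holds e near A.tr σ ↔ near (A.subst σ) := by
  have hf := fresh_notMem A.noemata
  simp only [Fm.tr, holds_ex, holds_mem]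
  constructor
  · rintro ⟨c, hc, h⟩
    rwa [member_compr_subst (hσ.update _ hc), Fm.subst_update hf, Fm.subst_update hf] at h
  · intro h
    refine ⟨.T, isCognomen_T, ?_⟩
    rwa [member_compr_subst (hσ.update _ isCognomen_T), Fm.subst_update hf, Fm.subst_update hf]

theorem Ident.refl (near : Fm → Prop) (a : Tm) : Ident near a a := fun _ _ _ => Iff.rfl
theorem Ident.symm {a b : Tm} (h : Ident near a b) : Ident near b a :=
  fun u A hA => (h u A hA).symm
theorem Ident.trans {a b c : Tm} (h : Ident near a b) (h' : Ident near b c) : Ident near a c :=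
  fun u A hA => (h u A hA).trans (h' u A hA)

theorem isAssignment_name (he : IsEnumeration e) (near : Fm → Prop) :
    IsAssignment (name e near) := by
  intro n
  induction n with
  | zero => rw [name]; exact he.isCognomen 0
  | succ n ih =>
    rw [name]; split_ifs
    · exact ih
    · exact he.isCognomen _

/-- What noemata name depends only on the identities that hold. -/
theorem name_congr (he : IsEnumeration e) {near near' : Fm → Prop}
    (h : ∀ a b : Tm, a.IsCognomen → b.IsCognomen → (Ident near a b ↔ Ident near' a b)) :
    name e near = name e near' := by
  classical
  funext n
  induction n using Nat.strong_induction_on with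
  | _ n ih =>
    cases n with
    | zero => rw [name, name]
    | succ n =>
      rw [name, name, ih n (Nat.lt_succ_self n)]
      refine if_congr (exists_congr fun m => ?_) rfl rfl
      rw [ih m m.2]
      exact h _ _ (isAssignment_name he near' m) (he.isCognomen _)

end Truth

/-! ### The stages -/

section Stages

variable {e : ℕ → Tm}

/-- `nearAt e γ A`: from some stage below `γ` on, and up to `γ`, the formula `A` has held. -/
def nearAt (e : ℕ → Tm) (γ : Ordinal.{0}) (A : Fm) : Prop :=
  ∃ β, β < γ ∧ ∀ δ, δ < γ → β ≤ δ → Sat e δ A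

theorem sat_iff (γ : Ordinal.{0}) (A : Fm) :
    Sat e γ A ↔ Holds e (nearAt e γ) A (name e (nearAt e γ)) := by
  rw [Sat]; rfl

theorem sat_subst {σ : ℕ → Tm} (hσ : IsAssignment σ) (γ : Ordinal.{0}) (A : Fm) :
    Sat e γ (A.subst σ) ↔ Holds e (nearAt e γ) A σ := by
  rw [sat_iff, holds_subst _ A hσ.isPartialAssignment, hσ.comp]

theorem nearAt_succ (γ : Ordinal.{0}) (A : Fm) : nearAt e (Order.succ γ) A ↔ Sat e γ A := by
  constructor
  · rintro ⟨β, hβ, h⟩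
    exact h γ (Order.lt_succ γ) (Order.lt_succ_iff.1 hβ)
  · intro h
    refine ⟨γ, Order.lt_succ γ, fun δ h1 h2 => ?_⟩
    rwa [le_antisymm (Order.lt_succ_iff.1 h1) h2]

theorem mem_trueAt (he : IsEnumeration e) (γ : Ordinal.{0}) (A : Fm) :
    A ∈ trueAt e γ ↔ nearAt e γ (A.subst (name e (nearAt e γ))) := by
  rw [trueAt, Set.mem_ofPred_eq, sat_iff, holds_tr (isAssignment_name he _)]

/-- Identities only get lost in the process: as `b ∈ {u | u = b}` has always held, a cognomen
identical with `b` has been identical with `b` at unboundedly many earlier stages. -/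
theorem Ident.antitone {a b : Tm} (ha : a.IsCognomen) (hb : b.IsCognomen) {γ δ : Ordinal.{0}}
    (h : Ident (nearAt e γ) a b) (hδ : δ ≤ γ) : Ident (nearAt e δ) a b := by
  induction γ using WellFoundedLT.induction generalizing δ with
  | _ γ ih =>
    rcases hδ.eq_or_lt with rfl | hlt
    · exact h
    -- the abstract `{v 0 | v 0 = v 1}`, with `v 1` replaced by `b`
    have hcl : ((Tm.compr 0 (.eq (.v 0) (.v 1))).subst fun _ => b).IsCognomen :=
      IsAssignment.isCognomen_subst (fun _ => hb) _
    have hmem := h.member (e := e) _ hcl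
    rw [member_compr_subst fun _ => hb, member_compr_subst fun _ => hb] at hmem
    have key : ∀ (c : Tm) (_ : c.IsCognomen) (γ' : Ordinal.{0}),
        Sat e γ' ((Fm.eq (.v 0) (.v 1)).subst
        (Function.update (fun _ => b) 0 c)) ↔ Ident (nearAt e γ') c b := fun c hc γ' => by
      rw [sat_subst (IsAssignment.update (fun _ => hb) 0 hc), holds_eq]
      simp [Tm.subst]
    obtain ⟨β, hβ, hs⟩ := hmem.2 ⟨δ, hlt, fun δ' _ _ => (key b hb δ').2 (Ident.refl _ _)⟩
    exact ih (max β δ) (max_lt hβ hlt)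
      ((key a ha _).1 (hs _ (max_lt hβ hlt) (le_max_left _ _))) (le_max_right _ _)

/-! ### Stabilization -/

/-- From some stage on, the identities between cognomina do not change any more. -/
theorem exists_forall_ident_iff (e : ℕ → Tm) : ∃ β : Ordinal.{0}, ∀ γ, β ≤ γ → ∀ a b : Tm,
    a.IsCognomen → b.IsCognomen → (Ident (nearAt e γ) a b ↔ Ident (nearAt e β) a b) := by
  have h : ∀ p : Tm × Tm, ∃ β : Ordinal.{0}, ∀ γ, Ident (nearAt e β) p.1 p.2 →
      β ≤ γ → Ident (nearAt e γ) p.1 p.2 := fun p => by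
    by_cases h : ∃ β, ¬ Ident (nearAt e β) p.1 p.2
    · obtain ⟨β, hβ⟩ := h
      exact ⟨β, fun γ h' => absurd h' hβ⟩
    · push Not at h
      exact ⟨0, fun γ _ _ => h γ⟩
  choose f hf using h
  have hle : ∀ p, f p ≤ ⨆ p, f p := fun p => Ordinal.le_iSup f p
  refine ⟨⨆ p, f p, fun γ hγ a b ha hb => ⟨fun h => h.antitone ha hb hγ, fun h => ?_⟩⟩
  exact hf (a, b) γ (h.antitone ha hb (hle (a, b))) ((hle (a, b)).trans hγ)

/-- Stabilizing ordinals exist.  Once all stably true and stably untrue formulas, and the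
identities, have settled, take a limit of stages between any two of which each formula that is not
stably true fails at some stage. -/
theorem exists_stabilizes (he : IsEnumeration e) : ∃ κ, Stabilizes e κ := by
  obtain ⟨β₀, hβ₀⟩ := exists_forall_ident_iff e
  have hname : ∀ γ, β₀ ≤ γ → name e (nearAt e γ) = name e (nearAt e β₀) := fun γ hγ =>
    name_congr he (hβ₀ γ hγ)
  have hin : ∀ A : Fm, ∃ β, A ∈ stableIn e → ∀ γ, β ≤ γ → A ∈ trueAt e γ := fun A => by
    by_cases h : A ∈ stableIn e
    · obtain ⟨β, hβ⟩ := h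
      exact ⟨β, fun _ => hβ⟩
    · exact ⟨0, fun h' => absurd h' h⟩
  have hout : ∀ A : Fm, ∃ β, A ∈ stableOut e → ∀ γ, β ≤ γ → A ∉ trueAt e γ := fun A => by
    by_cases h : A ∈ stableOut e
    · obtain ⟨β, hβ⟩ := h
      exact ⟨β, fun _ => hβ⟩
    · exact ⟨0, fun h' => absurd h' h⟩
  have hfail : ∀ (γ : Ordinal.{0}) (A : Fm), ∃ δ, γ ≤ δ ∧ (A ∉ stableIn e → A ∉ trueAt e δ) :=
    fun γ A => by
      by_cases h : A ∈ stableIn e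
      · exact ⟨γ, le_rfl, fun h' => absurd h h'⟩
      · simp only [stableIn, Set.mem_ofPred_eq] at h
        push Not at h
        obtain ⟨δ, hδ, h'⟩ := h γ
        exact ⟨δ, hδ, fun _ => h'⟩
  choose f hf using hin
  choose g hg using hout
  choose d hd hdA using hfail
  let s : ℕ → Ordinal.{0} := fun n => Nat.rec (max β₀ (max (⨆ A, f A) (⨆ A, g A)))
    (fun _ γ => Order.succ (⨆ A, d (Order.succ γ) A)) n
  have hs : ∀ n, s (n + 1) = Order.succ (⨆ A, d (Order.succ (s n)) A) := fun _ => rfl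
  have hds : ∀ n A, d (Order.succ (s n)) A < s (n + 1) := fun n A => by
    rw [hs, Order.lt_succ_iff]
    exact Ordinal.le_iSup (fun A => d (Order.succ (s n)) A) A
  have hss : ∀ n, s n < s (n + 1) := fun n =>
    (Order.lt_succ _).trans ((hd _ (.mem .T .T)).trans_lt (hds n _))
  have hlt : ∀ n, s n < ⨆ n, s n := fun n => (hss n).trans_le (Ordinal.le_iSup s (n + 1))
  have hκ : ∀ γ, (⨆ n, s n) ≤ γ → max β₀ (max (⨆ A, f A) (⨆ A, g A)) ≤ γ := fun γ hγ =>
    (hlt 0).le.trans hγ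
  have hf' : ∀ γ, (⨆ n, s n) ≤ γ → ∀ A, f A ≤ γ := fun γ hγ A =>
    (Ordinal.le_iSup f A).trans
      ((le_max_left _ _).trans ((le_max_right _ _).trans (hκ γ hγ)))
  have hg' : ∀ γ, (⨆ n, s n) ≤ γ → ∀ A, g A ≤ γ := fun γ hγ A =>
    (Ordinal.le_iSup g A).trans
      ((le_max_right _ _).trans ((le_max_right _ _).trans (hκ γ hγ)))
  have hβ : ∀ n, β₀ ≤ s n := fun n => by
    induction n with
    | zero => exact le_max_left _ _
    | succ n ih => exact ih.trans (hss n).le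
  refine ⟨⨆ n, s n, ⟨?_, fun γ hγ => ⟨fun A hA => hf A hA γ (hf' γ hγ A), fun A hA => ?_⟩⟩,
    fun A hA => ?_⟩
  · refine Order.isSuccLimit_iff _ |>.2 ⟨fun h => (hlt 0).not_ge (h (hlt 0).le), ?_⟩
    refine Order.isSuccPrelimit_of_succ_lt fun γ hγ => ?_
    obtain ⟨n, hn⟩ := Ordinal.lt_iSup_iff.1 hγ
    exact (Order.succ_le_of_lt hn).trans_lt (hlt n)
  · by_cases h : A ∈ stableIn e
    · exact Or.inl h
    · refine Or.inr fun h' => ?_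
      exact hg A (h'.resolve_left h) γ (hg' γ hγ A) hA
  · by_contra h
    rw [mem_trueAt he, hname _ ((hβ 0).trans (hlt 0).le)] at hA
    obtain ⟨β, hβκ, hA⟩ := hA
    obtain ⟨n, hn⟩ := Ordinal.lt_iSup_iff.1 hβκ
    have h1 : s n < d (Order.succ (s n)) A := (Order.lt_succ _).trans_le (hd _ _)
    have h2 : d (Order.succ (s n)) A < ⨆ n, s n := (hds n A).trans (hlt (n + 1))
    refine hdA (Order.succ (s n)) A h ((mem_trueAt he _ _).2 ?_)
    rw [hname _ ((hβ n).trans h1.le)]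
    exact ⟨β, hn.trans h1, fun δ hδ => hA δ (hδ.trans h2)⟩

theorem stabilizes_koppa (he : IsEnumeration e) : Stabilizes e (koppa e) :=
  csInf_mem (exists_stabilizes he)

/-- A closed formula that has held from some stage on below the closure ordinal holds from then on
forever. -/
theorem nearAt_koppa (he : IsEnumeration e) {A : Fm} {σ : ℕ → Tm} (hσ : IsAssignment σ) :
    nearAt e (koppa e) (A.subst σ) ↔ ∀ γ, koppa e ≤ γ → Holds e (nearAt e γ) A σ := by
  have hcl : ∀ τ : ℕ → Tm, (A.subst σ).subst τ = A.subst σ := fun τ => by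
    rw [Fm.subst_subst _ hσ.isPartialAssignment, hσ.comp]
  have htrue : ∀ γ, A.subst σ ∈ trueAt e γ ↔ nearAt e γ (A.subst σ) := fun γ => by
    rw [mem_trueAt he, hcl]
  have hst := stabilizes_koppa he
  constructor
  · intro h γ hγ
    have := (hst.1.2 (Order.succ γ) (hγ.trans (Order.le_succ γ))).1 (hst.2 ((htrue _).2 h))
    rwa [htrue, nearAt_succ, sat_subst hσ] at this
  · intro h
    refine (htrue _).1 ((hst.1.2 _ le_rfl).1 ⟨Order.succ (koppa e), fun γ hγ => ?_⟩)
    exact (htrue γ).2 ⟨koppa e, (Order.lt_succ _).trans_le hγ,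
      fun δ _ hδ => (sat_subst hσ δ A).2 (h δ hδ)⟩

/-- A formula whose truth value is constant from the closure ordinal on has that truth value
"near" every such stage, the closure ordinal included. -/
theorem nearAt_iff_of_forall (he : IsEnumeration e) {A : Fm} {σ : ℕ → Tm} (hσ : IsAssignment σ)
    {p : Prop} (h : ∀ δ, koppa e ≤ δ → (Holds e (nearAt e δ) A σ ↔ p)) {γ : Ordinal.{0}}
    (hγ : koppa e ≤ γ) : nearAt e γ (A.subst σ) ↔ p := by
  rcases hγ.eq_or_lt with rfl | hlt
  · rw [nearAt_koppa he hσ]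
    exact ⟨fun h' => (h _ le_rfl).1 (h' _ le_rfl), fun hp γ hγ => (h γ hγ).2 hp⟩
  · constructor
    · rintro ⟨β, hβ, h'⟩
      refine (h _ (le_max_right β _)).1 ((sat_subst hσ _ _).1 (h' _ (max_lt hβ hlt) ?_))
      exact le_max_left _ _
    · intro hp
      exact ⟨koppa e, hlt, fun δ _ hδ => (sat_subst hσ _ _).2 ((h δ hδ).2 hp)⟩

/-! ### Identity and naming from the closure ordinal on -/

/-- Identity of cognomina at the closure ordinal. -/
def Same (e : ℕ → Tm) (a b : Tm) : Prop := Ident (nearAt e (koppa e)) a b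

/-- What the noemata name at the closure ordinal. -/
noncomputable def named (e : ℕ → Tm) : ℕ → Tm := name e (nearAt e (koppa e))

theorem isAssignment_named (he : IsEnumeration e) : IsAssignment (named e) :=
  isAssignment_name he _

theorem ident_iff_same (he : IsEnumeration e) {a b : Tm} (ha : a.IsCognomen) (hb : b.IsCognomen)
    {γ : Ordinal.{0}} (hγ : koppa e ≤ γ) : Ident (nearAt e γ) a b ↔ Same e a b := by
  refine ⟨fun h => h.antitone ha hb hγ, fun h => ?_⟩
  have hσ := isAssignment_trivial.update 0 hb
  -- the cognomen `{v 1 | v 1 = b}` contains `b`, hence `a`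
  have hm := h.member (e := e) _ (hσ.isCognomen_subst (.compr 1 (.eq (.v 1) (.v 0))))
  rw [member_compr_subst hσ, member_compr_subst hσ, nearAt_koppa he (hσ.update 1 ha),
    nearAt_koppa he (hσ.update 1 hb)] at hm
  have := hm.2 (fun δ _ => (holds_eq _ _ _ _ _).2 (by simpa [Tm.subst] using Ident.refl _ b)) γ hγ
  simpa [holds_eq, Tm.subst] using this

theorem name_eq_named (he : IsEnumeration e) {γ : Ordinal.{0}} (hγ : koppa e ≤ γ) :
    name e (nearAt e γ) = named e :=
  name_congr he fun _ _ ha hb => ident_iff_same he ha hb hγ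

/-- A formula is a maxim just in case it holds at all stages from the closure ordinal on. -/
theorem maxim_iff (he : IsEnumeration e) (A : Fm) :
    Maxim e A ↔ ∀ γ, koppa e ≤ γ → Holds e (nearAt e γ) A (named e) := by
  rw [← nearAt_koppa he (isAssignment_named he)]
  exact mem_trueAt he _ A

/-- Indiscernibility of identicals. -/
theorem Same.holds_iff (he : IsEnumeration e) {a b : Tm} (ha : a.IsCognomen) (hb : b.IsCognomen)
    (h : Same e a b) {σ : ℕ → Tm} (hσ : IsAssignment σ) (u : ℕ) (A : Fm) {γ : Ordinal.{0}}
    (hγ : koppa e ≤ γ) : Holds e (nearAt e γ) A (Function.update σ u a) ↔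
      Holds e (nearAt e γ) A (Function.update σ u b) := by
  have hm := ((ident_iff_same he ha hb (hγ.trans (Order.le_succ γ))).2 h).member (e := e) _
    (hσ.isCognomen_subst (.compr u A))
  rwa [member_compr_subst hσ, member_compr_subst hσ, nearAt_succ, nearAt_succ,
    sat_subst (hσ.update u ha), sat_subst (hσ.update u hb)] at hm

end Stages

/-! ### Pairs, numerals and the enumerator from the closure ordinal on -/

theorem fresh_eq_zero {s : Finset ℕ} (h : 0 ∉ s) : fresh s = 0 :=
  Nat.sInf_eq_zero.2 (Or.inl h)

theorem fresh_eq_one {s : Finset ℕ} (h0 : 0 ∈ s) (h1 : 1 ∉ s) : fresh s = 1 := by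
  have hle : fresh s ≤ 1 := Nat.sInf_le h1
  have hne : fresh s ≠ 0 := fun h => fresh_notMem s (by rwa [h])
  omega

theorem Fm.noemata_or (A B : Fm) : (Fm.or A B).noemata = A.noemata ∪ B.noemata := by
  simp [Fm.or, Fm.noemata]

theorem Fm.noemata_eq (a b : Tm) : (Fm.eq a b).noemata = a.noemata ∪ b.noemata := by
  have := fresh_notMem (a.noemata ∪ b.noemata)
  ext n
  simp only [Fm.eq, Fm.imp, Fm.noemata, Tm.noemata]
  grind

theorem Tm.noemata_sing (a : Tm) : a.sing.noemata = a.noemata := by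
  have := fresh_notMem a.noemata
  simp only [Tm.sing, Tm.noemata, Fm.noemata_eq]
  grind

theorem Tm.noemata_upair (a b : Tm) : (a.upair b).noemata = a.noemata ∪ b.noemata := by
  have := fresh_notMem (a.noemata ∪ b.noemata)
  simp only [Tm.upair, Tm.noemata, Fm.noemata_eq, Fm.noemata_or]
  grind

theorem Tm.noemata_succ (a : Tm) : a.succ.noemata = a.noemata := by
  have := fresh_notMem a.noemata
  simp only [Tm.succ, Tm.noemata, Fm.noemata_eq, Fm.noemata_or, Fm.noemata]
  grind

theorem Tm.IsCognomen.sing {a : Tm} (ha : a.IsCognomen) : a.sing.IsCognomen :=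
  a.noemata_sing.trans ha

theorem Tm.IsCognomen.upair {a b : Tm} (ha : a.IsCognomen) (hb : b.IsCognomen) :
    (a.upair b).IsCognomen := by
  rw [Tm.IsCognomen, Tm.noemata_upair, ha, hb, Finset.empty_union]

theorem Tm.IsCognomen.succ {a : Tm} (ha : a.IsCognomen) : a.succ.IsCognomen :=
  a.noemata_succ.trans ha

theorem isCognomen_zero : Tm.zero.IsCognomen := by
  simp [Tm.zero, Tm.IsCognomen, Tm.noemata, Fm.neg, Fm.noemata, Fm.noemata_eq]

theorem isCognomen_numeral : ∀ n, (Tm.numeral n).IsCognomen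
  | 0 => isCognomen_zero
  | n + 1 => (isCognomen_numeral n).succ

theorem isCognomen_nat : Tm.nat.IsCognomen := by
  have h0 : Tm.zero.noemata = ∅ := isCognomen_zero
  ext n
  simp [Tm.nat, Tm.noemata, Fm.imp, Fm.and, Fm.noemata, Tm.noemata_succ, h0]
  grind

section Subst

variable {σ : ℕ → Tm} {a b : Tm}

theorem Fm.eq_subst (hσ : IsAssignment σ) (h0 : 0 ∉ a.noemata) (h1 : 1 ∉ a.noemata) :
    (Fm.eq (.v 0) a).subst (Function.update σ 0 (.v 0)) = Fm.eq (.v 0) (a.subst σ) := by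
  have ha : (a.subst σ).noemata = ∅ := hσ.isCognomen_subst a
  have e1 : fresh ((Tm.v 0).noemata ∪ a.noemata) = 1 :=
    fresh_eq_one (by simp [Tm.noemata]) (by simp [Tm.noemata, h1])
  have e2 : fresh ((Tm.v 0).noemata ∪ (a.subst σ).noemata) = 1 :=
    fresh_eq_one (by simp [Tm.noemata]) (by simp [Tm.noemata, ha])
  simp [Fm.eq, e1, e2, Fm.imp, Fm.subst, Tm.subst, Tm.subst_update h0, Tm.subst_update h1]

theorem Tm.sing_subst (hσ : IsAssignment σ) (h0 : 0 ∉ a.noemata) (h1 : 1 ∉ a.noemata) :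
    a.sing.subst σ = (a.subst σ).sing := by
  have ha : (a.subst σ).noemata = ∅ := hσ.isCognomen_subst a
  simp only [Tm.sing, fresh_eq_zero h0, ha, fresh_eq_zero (Finset.notMem_empty 0), Tm.subst,
    Fm.eq_subst hσ h0 h1]

theorem Tm.upair_subst (hσ : IsAssignment σ) (h0 : 0 ∉ a.noemata) (h1 : 1 ∉ a.noemata)
    (k0 : 0 ∉ b.noemata) (k1 : 1 ∉ b.noemata) :
    (a.upair b).subst σ = (a.subst σ).upair (b.subst σ) := by
  have ha : (a.subst σ).noemata = ∅ := hσ.isCognomen_subst a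
  have hb : (b.subst σ).noemata = ∅ := hσ.isCognomen_subst b
  have hab : 0 ∉ a.noemata ∪ b.noemata := by simp [h0, k0]
  simp only [Tm.upair, fresh_eq_zero hab, ha, hb, Finset.empty_union,
    fresh_eq_zero (Finset.notMem_empty 0), Tm.subst, Fm.or, Fm.subst, Fm.eq_subst hσ h0 h1,
    Fm.eq_subst hσ k0 k1]

theorem Tm.pair_subst (hσ : IsAssignment σ) (h0 : 0 ∉ a.noemata) (h1 : 1 ∉ a.noemata)
    (k0 : 0 ∉ b.noemata) (k1 : 1 ∉ b.noemata) :
    (a.pair b).subst σ = (a.subst σ).pair (b.subst σ) := by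
  rw [Tm.pair, Tm.upair_subst hσ, Tm.sing_subst hσ h0 h1, Tm.upair_subst hσ h0 h1 k0 k1, Tm.pair]
  all_goals simp [Tm.noemata_sing, Tm.noemata_upair, *]

theorem Tm.succ_subst (hσ : IsAssignment σ) (h0 : 0 ∉ a.noemata) (h1 : 1 ∉ a.noemata) :
    a.succ.subst σ = (a.subst σ).succ := by
  have ha : (a.subst σ).noemata = ∅ := hσ.isCognomen_subst a
  simp only [Tm.succ, fresh_eq_zero h0, ha, fresh_eq_zero (Finset.notMem_empty 0), Tm.subst,
    Fm.or, Fm.subst, Fm.eq_subst hσ h0 h1, Tm.subst_update h0, Function.update_self]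

end Subst

theorem Tm.IsCognomen.pair {a b : Tm} (ha : a.IsCognomen) (hb : b.IsCognomen) :
    (a.pair b).IsCognomen := ha.sing.upair (ha.upair hb)

section Members

variable {e : ℕ → Tm} {γ : Ordinal.{0}} {a b c d : Tm}

theorem Same.refl (e : ℕ → Tm) (a : Tm) : Same e a a := Ident.refl _ a
theorem Same.symm (h : Same e a b) : Same e b a := Ident.symm h
theorem Same.trans (h : Same e a b) (h' : Same e b c) : Same e a c := Ident.trans h h'

theorem Same.member_iff_left (he : IsEnumeration e) (ha : a.IsCognomen) (hb : b.IsCognomen)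
    (h : Same e a b) (hc : c.IsCognomen) (hγ : koppa e ≤ γ) :
    Member e (nearAt e γ) a c ↔ Member e (nearAt e γ) b c :=
  ((ident_iff_same he ha hb hγ).2 h).member c hc

theorem Same.member_iff_right (he : IsEnumeration e) (ha : a.IsCognomen) (hb : b.IsCognomen)
    (h : Same e a b) (hc : c.IsCognomen) (hγ : koppa e ≤ γ) :
    Member e (nearAt e γ) c a ↔ Member e (nearAt e γ) c b := by
  simpa [holds_mem, Tm.subst, hc.subst] using
    h.holds_iff he ha hb isAssignment_trivial 0 (.mem c (.v 0)) hγ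

/-- Membership in an abstract whose condition has a constant truth value. -/
theorem member_compr_iff (he : IsEnumeration e) {u : ℕ} {A : Fm} {σ : ℕ → Tm}
    (hσ : IsAssignment σ) (hc : c.IsCognomen) {p : Prop}
    (h : ∀ δ, koppa e ≤ δ → (Holds e (nearAt e δ) A (Function.update σ u c) ↔ p))
    (hγ : koppa e ≤ γ) : Member e (nearAt e γ) c ((Tm.compr u A).subst σ) ↔ p := by
  rw [member_compr_subst hσ]
  exact nearAt_iff_of_forall he (hσ.update u hc) h hγ

theorem member_sing (he : IsEnumeration e) (ha : a.IsCognomen) (hc : c.IsCognomen)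
    (hγ : koppa e ≤ γ) : Member e (nearAt e γ) c a.sing ↔ Same e c a := by
  rw [← ha.sing.subst trivialAssignment]
  refine member_compr_iff he isAssignment_trivial hc (fun δ hδ => ?_) hγ
  simp [holds_eq, Tm.subst, ha.subst, ident_iff_same he hc ha hδ]

theorem member_upair (he : IsEnumeration e) (ha : a.IsCognomen) (hb : b.IsCognomen)
    (hc : c.IsCognomen) (hγ : koppa e ≤ γ) :
    Member e (nearAt e γ) c (a.upair b) ↔ Same e c a ∨ Same e c b := by
  rw [← (ha.upair hb).subst trivialAssignment]
  refine member_compr_iff he isAssignment_trivial hc (fun δ hδ => ?_) hγ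
  simp [holds_or, holds_eq, Tm.subst, ha.subst, hb.subst, ident_iff_same he hc ha hδ,
    ident_iff_same he hc hb hδ]

theorem Same.sing_inj (he : IsEnumeration e) (ha : a.IsCognomen) (hb : b.IsCognomen)
    (h : Same e a.sing b.sing) : Same e a b := by
  have := h.member_iff_right he ha.sing hb.sing ha le_rfl
  rw [member_sing he ha ha le_rfl, member_sing he hb ha le_rfl] at this
  exact this.1 (Same.refl e a)

theorem Same.sing_upair (he : IsEnumeration e) (ha : a.IsCognomen) (hb : b.IsCognomen)
    (hc : c.IsCognomen) (h : Same e a.sing (b.upair c)) : Same e b a ∧ Same e c a := by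
  have key := fun d hd => h.member_iff_right he ha.sing (hb.upair hc) (c := d) hd le_rfl
  constructor
  · have := key b hb
    rw [member_sing he ha hb le_rfl, member_upair he hb hc hb le_rfl] at this
    exact this.2 (Or.inl (Same.refl e b))
  · have := key c hc
    rw [member_sing he ha hc le_rfl, member_upair he hb hc hc le_rfl] at this
    exact this.2 (Or.inr (Same.refl e c))

theorem Same.upair_inj_right (he : IsEnumeration e) (ha : a.IsCognomen) (hb : b.IsCognomen)
    (hc : c.IsCognomen) (hd : d.IsCognomen) (hac : Same e a c)
    (h : Same e (a.upair b) (c.upair d)) : Same e b d := by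
  have h1 := h.member_iff_right he (ha.upair hb) (hc.upair hd) hb le_rfl
  have h2 := h.member_iff_right he (ha.upair hb) (hc.upair hd) hd le_rfl
  rw [member_upair he ha hb hb le_rfl, member_upair he hc hd hb le_rfl] at h1
  rw [member_upair he ha hb hd le_rfl, member_upair he hc hd hd le_rfl] at h2
  rcases h1.1 (Or.inr (Same.refl e b)) with h3 | h3
  · rcases h2.2 (Or.inr (Same.refl e d)) with h4 | h4
    · exact (h3.trans hac.symm).trans h4.symm
    · exact h4.symm
  · exact h3

/-- Kuratowski pairs determine their components up to identity. -/
theorem Same.pair_inj (he : IsEnumeration e) (ha : a.IsCognomen) (hb : b.IsCognomen)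
    (hc : c.IsCognomen) (hd : d.IsCognomen) (h : Same e (a.pair b) (c.pair d)) :
    Same e a c ∧ Same e b d := by
  have key := fun x hx => h.member_iff_right he (ha.pair hb) (hc.pair hd) (c := x) hx le_rfl
  have h1 := key _ ha.sing
  have hac : Same e a c := by
    rw [Tm.pair, Tm.pair, member_upair he ha.sing (ha.upair hb) ha.sing le_rfl,
      member_upair he hc.sing (hc.upair hd) ha.sing le_rfl] at h1
    rcases h1.1 (Or.inl (Same.refl e _)) with h2 | h2
    · exact h2.sing_inj he ha hc
    · exact (h2.sing_upair he ha hc hd).1.symm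
  have hsing : Same e a.sing c.sing := by
    have := hac.holds_iff he ha hc isAssignment_trivial 2
      (.eq (.sing (.v 2)) a.sing) (le_refl (koppa e))
    simp only [holds_eq, ha.sing.subst,
      Tm.sing_subst (isAssignment_trivial.update 2 ha) (a := .v 2) (by simp [Tm.noemata])
        (by simp [Tm.noemata]),
      Tm.sing_subst (isAssignment_trivial.update 2 hc) (a := .v 2) (by simp [Tm.noemata])
        (by simp [Tm.noemata]), Tm.subst, Function.update_self] at this
    exact (this.1 (Ident.refl _ _)).symm
  exact ⟨hac, hac.upair_inj_right he ha hb hc hd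
    (hsing.upair_inj_right he ha.sing (ha.upair hb) hc.sing (hc.upair hd) h)⟩

theorem member_zero (he : IsEnumeration e) (hc : c.IsCognomen) (hγ : koppa e ≤ γ) :
    ¬ Member e (nearAt e γ) c .zero := by
  rw [← isCognomen_zero.subst trivialAssignment]
  refine (member_compr_iff he isAssignment_trivial hc (p := False) (fun δ hδ => ?_) hγ).1
  simpa [holds_neg, holds_eq] using Ident.refl _ _

theorem member_numeral (he : IsEnumeration e) (hc : c.IsCognomen) (hγ : koppa e ≤ γ) (m : ℕ) :
    Member e (nearAt e γ) c (.numeral m) ↔ ∃ n < m, Same e c (.numeral n) := by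
  induction m generalizing γ with
  | zero => simpa [Tm.numeral] using member_zero he hc hγ
  | succ m ih =>
    have hm := isCognomen_numeral m
    rw [← (isCognomen_numeral (m + 1)).subst trivialAssignment]
    refine member_compr_iff he isAssignment_trivial hc (fun δ hδ => ?_) hγ
    simp [holds_or, holds_mem, holds_eq, Tm.subst, hm.subst, ih hδ, ident_iff_same he hc hm hδ,
      -Order.lt_add_one_iff, Nat.lt_succ_iff_lt_or_eq, or_and_right, exists_or]

theorem not_same_numeral_of_lt (he : IsEnumeration e) {m n : ℕ} (h : m < n) :
    ¬ Same e (.numeral m) (.numeral n) := by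
  induction m using Nat.strong_induction_on generalizing n with
  | _ m ih =>
    intro hs
    -- `m` belongs to `n`, so to itself, and thus is identical with a smaller numeral
    have h1 := (member_numeral he (isCognomen_numeral m) le_rfl n).2 ⟨m, h, Same.refl e _⟩
    rw [← hs.member_iff_right he (isCognomen_numeral m) (isCognomen_numeral n)
      (isCognomen_numeral m) le_rfl, member_numeral he (isCognomen_numeral m) le_rfl] at h1
    obtain ⟨k, hk, hks⟩ := h1
    exact ih k hk hk hks.symm

theorem member_numeral_numeral (he : IsEnumeration e) (hγ : koppa e ≤ γ) {m n : ℕ} :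
    Member e (nearAt e γ) (.numeral m) (.numeral n) ↔ m < n := by
  rw [member_numeral he (isCognomen_numeral m) hγ]
  constructor
  · rintro ⟨k, hk, h⟩
    rcases lt_trichotomy m k with h' | rfl | h'
    · exact absurd h (not_same_numeral_of_lt he h')
    · exact hk
    · exact absurd h.symm (not_same_numeral_of_lt he h')
  · exact fun h => ⟨m, h, Same.refl e _⟩

theorem numeral_member_nat (he : IsEnumeration e) (hγ : koppa e ≤ γ) (n : ℕ) :
    Member e (nearAt e γ) (.numeral n) .nat := by
  have hσ := isAssignment_trivial.update 0 (isCognomen_numeral n)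
  rw [← isCognomen_nat.subst trivialAssignment]
  refine (member_compr_iff he isAssignment_trivial (isCognomen_numeral n) (p := True)
    (fun δ hδ => iff_true_intro ?_) hγ).2 trivial
  rw [holds_all]
  intro y hy
  simp only [holds_imp, holds_and, holds_mem, holds_all, isCognomen_zero.subst]
  rintro ⟨h0, hs⟩
  have : ∀ m, Member e (nearAt e δ) (.numeral m) y := fun m => by
    induction m with
    | zero => simpa [Tm.subst, Tm.numeral] using h0
    | succ m ih =>
      have := hs _ (isCognomen_numeral m)
      rw [Tm.succ_subst ((hσ.update 1 hy).update 2 (isCognomen_numeral m))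
        (by simp [Tm.noemata]) (by simp [Tm.noemata])] at this
      simp only [Tm.subst, Function.update_self] at this
      exact this (by simpa using ih)
  simpa [Tm.subst] using this n

/-- The enumerator pairs `n` only with what `v n` names. -/
theorem exists_of_pair_member_E (he : IsEnumeration e) (ha : a.IsCognomen) (hb : b.IsCognomen)
    (hγ : koppa e ≤ γ) (h : Member e (nearAt e γ) (a.pair b) .E) :
    ∃ n, Same e a (.numeral n) ∧ Same e b (named e n) := by
  simp only [Member, name_eq_named he hγ] at h
  obtain ⟨c, n, hc, h1, h2⟩ := h
  have hn := isCognomen_numeral n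
  rw [ident_iff_same he (ha.pair hb) (hn.pair hc) hγ] at h1
  rw [ident_iff_same he hc (isAssignment_named he n) hγ] at h2
  obtain ⟨h3, h4⟩ := h1.pair_inj he ha hb hn hc
  exact ⟨n, h3, h4.trans h2⟩

theorem numeral_pair_member_E (he : IsEnumeration e) (hb : b.IsCognomen) (hγ : koppa e ≤ γ)
    {n : ℕ} (h : Same e b (named e n)) :
    Member e (nearAt e γ) (.pair (.numeral n) b) .E := by
  simp only [Member, name_eq_named he hγ]
  exact ⟨b, n, hb, Ident.refl _ _, (ident_iff_same he hb (isAssignment_named he n) hγ).2 h⟩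

end Members

/-! ### The order of the cognomina -/

section Order

variable {e : ℕ → Tm} {γ : Ordinal.{0}} {a b c : Tm} {σ : ℕ → Tm}

theorem exists_same_named (he : IsEnumeration e) (ha : a.IsCognomen) :
    ∃ n, Same e a (named e n) := by
  obtain ⟨n, rfl⟩ := he.surjective a ha
  cases n with
  | zero => exact ⟨0, by rw [named, name]; exact Same.refl e _⟩
  | succ n =>
    by_cases h : ∃ m : Fin (n + 1), Same e (named e m) (e (n + 1))
    · obtain ⟨m, hm⟩ := h
      exact ⟨m, hm.symm⟩
    · refine ⟨n + 1, ?_⟩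
      have hn : named e (n + 1) = e (n + 1) := by
        conv_lhs => rw [named, name]
        exact if_neg h
      rw [hn]
      exact Same.refl e _

/-- Noemata that name the same cognomen form an interval, since a noema either continues its
predecessor or names something new. -/
theorem same_named_of_le {i j k : ℕ} (hij : i ≤ j) (hjk : j ≤ k)
    (h : Same e (named e i) (named e k)) : Same e (named e i) (named e j) := by
  induction k with
  | zero =>
    obtain rfl : j = 0 := by omega
    exact h
  | succ k ih =>
    rcases hjk.eq_or_lt with rfl | hjk
    · exact h
    refine ih (Nat.le_of_lt_succ hjk) ?_
    by_cases hex : ∃ m : Fin (k + 1), Same e (named e m) (e (k + 1))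
    · have : named e (k + 1) = named e k := by
        conv_lhs => rw [named, name]
        exact if_pos hex
      rwa [this] at h
    · have : named e (k + 1) = e (k + 1) := by
        conv_lhs => rw [named, name]
        exact if_neg hex
      rw [this] at h
      exact absurd ⟨⟨i, by omega⟩, h⟩ hex

/-- The index of the first noema that names `a` at the closure ordinal. -/
noncomputable def rank (e : ℕ → Tm) (a : Tm) : ℕ := sInf {n | Same e a (named e n)}

theorem same_named_rank (he : IsEnumeration e) (ha : a.IsCognomen) :
    Same e a (named e (rank e a)) := Nat.sInf_mem (exists_same_named he ha)

theorem rank_eq_iff (he : IsEnumeration e) (ha : a.IsCognomen) (hb : b.IsCognomen) :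
    rank e a = rank e b ↔ Same e a b := by
  constructor
  · intro h
    have h1 := same_named_rank he ha
    rw [h] at h1
    exact h1.trans (same_named_rank he hb).symm
  · intro h
    have : ∀ n, Same e a (named e n) ↔ Same e b (named e n) := fun n =>
      ⟨h.symm.trans, h.trans⟩
    simp only [rank, this]

theorem le_above {s : Finset ℕ} {n : ℕ} (h : n ∈ s) : n + 2 ≤ above s :=
  Nat.add_le_add_right (Finset.le_sup (f := id) h) 2

theorem two_le_above (s : Finset ℕ) : 2 ≤ above s := Nat.le_add_left _ _

theorem notMem_of_above_le {s : Finset ℕ} {n : ℕ} (h : above s ≤ n) : n ∉ s := fun hn => by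
  have := le_above hn; omega

theorem holds_prec (he : IsEnumeration e) (hσ : IsAssignment σ) {i j : ℕ} (hi : 2 ≤ i)
    (hj : 2 ≤ j) (hγ : koppa e ≤ γ) : Holds e (nearAt e γ) (.prec (.v i) (.v j)) σ ↔
      ∃ m n, m < n ∧ Same e (σ i) (named e m) ∧ Same e (σ j) (named e n) := by
  have hx2 := two_le_above ((Tm.v i).noemata ∪ (Tm.v j).noemata)
  have hix : i + 2 ≤ above ((Tm.v i).noemata ∪ (Tm.v j).noemata) :=
    le_above (by simp [Tm.noemata])
  have hjx : j + 2 ≤ above ((Tm.v i).noemata ∪ (Tm.v j).noemata) :=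
    le_above (by simp [Tm.noemata])
  simp only [Fm.prec, holds_ex]
  generalize above ((Tm.v i).noemata ∪ (Tm.v j).noemata) = x at *
  have key : ∀ p q : Tm, p.IsCognomen → q.IsCognomen → (Holds e (nearAt e γ)
      (.and (.mem (.v x) .nat) (.and (.mem (.v (x + 1)) .nat) (.and (.mem (.pair (.v x) (.v i)) .E)
        (.and (.mem (.pair (.v (x + 1)) (.v j)) .E) (.mem (.v x) (.v (x + 1)))))))
      (Function.update (Function.update σ x p) (x + 1) q) ↔
      Member e (nearAt e γ) p .nat ∧ Member e (nearAt e γ) q .nat ∧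
      Member e (nearAt e γ) (p.pair (σ i)) .E ∧ Member e (nearAt e γ) (q.pair (σ j)) .E ∧
      Member e (nearAt e γ) p q) := by
    intro p q hp hq
    have hτ := (hσ.update x hp).update (x + 1) hq
    have h1 : i ≠ x := by omega
    have h2 : i ≠ x + 1 := by omega
    have h3 : j ≠ x := by omega
    have h4 : j ≠ x + 1 := by omega
    simp only [holds_and, holds_mem, isCognomen_nat.subst]
    rw [Tm.pair_subst hτ, Tm.pair_subst hτ]
    · simp [Tm.subst, h1, h2, h3, h4]
    all_goals simp only [Tm.noemata, Finset.mem_singleton]; omega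
  constructor
  · rintro ⟨p, hp, q, hq, h⟩
    obtain ⟨-, -, h1, h2, h3⟩ := (key p q hp hq).1 h
    obtain ⟨m, hpm, hm⟩ := exists_of_pair_member_E he hp (hσ i) hγ h1
    obtain ⟨n, hqn, hn⟩ := exists_of_pair_member_E he hq (hσ j) hγ h2
    refine ⟨m, n, ?_, hm, hn⟩
    rwa [hpm.member_iff_left he hp (isCognomen_numeral m) hq hγ,
      hqn.member_iff_right he hq (isCognomen_numeral n) (isCognomen_numeral m) hγ,
      member_numeral_numeral he hγ] at h3
  · rintro ⟨m, n, hmn, hm, hn⟩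
    exact ⟨.numeral m, isCognomen_numeral m, .numeral n, isCognomen_numeral n,
      (key _ _ (isCognomen_numeral m) (isCognomen_numeral n)).2 ⟨numeral_member_nat he hγ m,
        numeral_member_nat he hγ n, numeral_pair_member_E he (hσ i) hγ hm,
        numeral_pair_member_E he (hσ j) hγ hn, (member_numeral_numeral he hγ).2 hmn⟩⟩

/-- The order induced by the enumerator compares ranks.  A cognomen may precede itself strictly,
when several noemata name it, but the reflexive closure is not affected by this. -/
theorem holds_preceq (he : IsEnumeration e) (hσ : IsAssignment σ) {i j : ℕ} (hi : 2 ≤ i)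
    (hj : 2 ≤ j) (hγ : koppa e ≤ γ) : Holds e (nearAt e γ) (.preceq (.v i) (.v j)) σ ↔
      rank e (σ i) ≤ rank e (σ j) := by
  have hri := same_named_rank he (hσ i)
  have hrj := same_named_rank he (hσ j)
  simp only [Fm.preceq, holds_or, holds_prec he hσ hi hj hγ, holds_eq, Tm.subst,
    ident_iff_same he (hσ i) (hσ j) hγ]
  constructor
  · rintro (⟨m, n, hmn, hm, hn⟩ | h)
    · by_contra! hlt
      have hle : rank e (σ i) ≤ m := Nat.sInf_le hm
      -- otherwise the interval of the names of `σ j` would contain a name of `σ i`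
      have := same_named_of_le (hlt.le.trans hle) hmn.le (hrj.symm.trans hn)
      have hs : Same e (σ i) (σ j) := hm.trans (this.symm.trans hrj.symm)
      exact hlt.ne' ((rank_eq_iff he (hσ i) (hσ j)).2 hs)
    · exact ((rank_eq_iff he (hσ i) (hσ j)).2 h).le
  · intro h
    rcases h.eq_or_lt with h | h
    · exact Or.inr ((rank_eq_iff he (hσ i) (hσ j)).1 h)
    · exact Or.inl ⟨_, _, h, hri, hrj⟩

theorem holds_least (he : IsEnumeration e) (hσ : IsAssignment σ) {i j : ℕ} (hi : 2 ≤ i)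
    (hγ : koppa e ≤ γ) : Holds e (nearAt e γ) (.least (.v i) (.v j)) σ ↔
      Member e (nearAt e γ) (σ i) (σ j) ∧ ∀ c : Tm, c.IsCognomen →
        Member e (nearAt e γ) c (σ j) → rank e (σ i) ≤ rank e c := by
  have hz2 := two_le_above ((Tm.v i).noemata ∪ (Tm.v j).noemata)
  have hiz : i + 2 ≤ above ((Tm.v i).noemata ∪ (Tm.v j).noemata) :=
    le_above (by simp [Tm.noemata])
  have hjz : j + 2 ≤ above ((Tm.v i).noemata ∪ (Tm.v j).noemata) :=
    le_above (by simp [Tm.noemata])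
  simp only [Fm.least, holds_and, holds_all, holds_imp, holds_mem]
  generalize above ((Tm.v i).noemata ∪ (Tm.v j).noemata) = z at *
  have h1 : i ≠ z := by omega
  have h2 : j ≠ z := by omega
  refine and_congr Iff.rfl (forall₂_congr fun c hc => ?_)
  rw [holds_preceq he (hσ.update z hc) hi hz2 hγ]
  simp [Tm.subst, h1, h2]

/-! ### Kinds and the choice term -/

/-- Membership in `b` is settled from the closure ordinal on. -/
def IsKind (e : ℕ → Tm) (b : Tm) : Prop := ∀ c : Tm, c.IsCognomen → ∀ γ, koppa e ≤ γ →
  (Member e (nearAt e γ) c b ↔ Member e (nearAt e (koppa e)) c b)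

theorem forall_holds_kind_iff (he : IsEnumeration e) (hσ : IsAssignment σ) (t : Tm) :
    (∀ γ, koppa e ≤ γ → Holds e (nearAt e γ) (.kind t) σ) ↔ IsKind e (t.subst σ) := by
  have hx : ∀ c, t.subst (Function.update σ (fresh t.noemata) c) = t.subst σ := fun c =>
    Tm.subst_update (fresh_notMem _) σ c
  have hmem : ∀ (c : Tm) γ, Holds e (nearAt e γ) (.mem (.v (fresh t.noemata)) t)
      (Function.update σ (fresh t.noemata) c) ↔ Member e (nearAt e γ) c (t.subst σ) :=
    fun c γ => by simp [holds_mem, hx, Tm.subst]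
  simp only [Fm.kind, holds_all, holds_or]
  constructor
  · intro h c hc γ hγ
    have hτ := hσ.update (fresh t.noemata) hc
    have := h _ le_rfl c hc
    rw [holds_tr hτ, holds_tr hτ, nearAt_koppa he hτ, nearAt_koppa he hτ] at this
    simp only [holds_neg, hmem] at this
    rcases this with h | h
    · exact iff_of_true (h γ hγ) (h _ le_rfl)
    · exact iff_of_false (h γ hγ) (h _ le_rfl)
  · intro h γ hγ c hc
    have hτ := hσ.update (fresh t.noemata) hc
    rw [holds_tr hτ, holds_tr hτ,
      nearAt_iff_of_forall he hτ (fun δ hδ => (hmem c δ).trans (h c hc δ hδ)) hγ,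
      nearAt_iff_of_forall he hτ
        (fun δ hδ => holds_neg.trans (not_congr ((hmem c δ).trans (h c hc δ hδ)))) hγ]
    exact em _

/-- `c` has the least rank among the members of `b`, at the closure ordinal. -/
def IsLeastIn (e : ℕ → Tm) (c b : Tm) : Prop := Member e (nearAt e (koppa e)) c b ∧
  ∀ d : Tm, d.IsCognomen → Member e (nearAt e (koppa e)) d b → rank e c ≤ rank e d

theorem IsKind.holds_least_iff (he : IsEnumeration e) (hσ : IsAssignment σ) {i j : ℕ} (hi : 2 ≤ i)
    (hγ : koppa e ≤ γ) (h : IsKind e (σ j)) :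
    Holds e (nearAt e γ) (.least (.v i) (.v j)) σ ↔ IsLeastIn e (σ i) (σ j) := by
  rw [holds_least he hσ hi hγ, IsLeastIn, h _ (hσ i) γ hγ]
  refine and_congr_right fun _ => forall₂_congr fun c hc => ?_
  rw [h c hc γ hγ]

theorem IsLeastIn.same (he : IsEnumeration e) {d : Tm} (hc : c.IsCognomen) (hd : d.IsCognomen)
    (h : IsLeastIn e c b) (h' : IsLeastIn e d b) : Same e c d :=
  (rank_eq_iff he hc hd).1 (le_antisymm (h.2 d hd h'.1) (h'.2 c hc h.1))

theorem exists_isLeastIn (hc : c.IsCognomen) (h : Member e (nearAt e (koppa e)) c b) :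
    ∃ d : Tm, d.IsCognomen ∧ IsLeastIn e d b := by
  obtain ⟨d, hd, hmin⟩ := (measure (rank e)).wf.has_min
    {d : Tm | d.IsCognomen ∧ Member e (nearAt e (koppa e)) d b} ⟨c, hc, h⟩
  exact ⟨d, hd.1, hd.2, fun d' h1 h2 => not_lt.1 (hmin d' ⟨h1, h2⟩)⟩

/-- The members of the choice term are the cognomina that are least in a member of `t`: as `t` and
its members are kinds, the defining condition has a constant truth value. -/
theorem member_choice (he : IsEnumeration e) (hσ : IsAssignment σ) (t : Tm)
    (ht : IsKind e (t.subst σ))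
    (hmem : ∀ b : Tm, b.IsCognomen → Member e (nearAt e (koppa e)) b (t.subst σ) → IsKind e b)
    (hc : c.IsCognomen) (hγ : koppa e ≤ γ) :
    Member e (nearAt e γ) c (t.choice.subst σ) ↔ ∃ b : Tm, b.IsCognomen ∧
      Member e (nearAt e (koppa e)) b (t.subst σ) ∧ IsLeastIn e c b := by
  refine member_compr_iff he hσ hc (fun δ hδ => ?_) hγ
  have h0 : above t.noemata ∉ t.noemata := notMem_of_above_le le_rfl
  have h1 : above t.noemata + 1 ∉ t.noemata := notMem_of_above_le (Nat.le_succ _)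
  simp only [holds_ex, holds_and, holds_mem, Tm.subst_update h0, Tm.subst_update h1]
  refine exists_congr fun b => and_congr_right fun hb => ?_
  simp only [Tm.subst, Function.update_self, ht b hb δ hδ]
  refine and_congr_right fun hbt => ?_
  have hτ := (hσ.update (above t.noemata) hc).update (above t.noemata + 1) hb
  rw [IsKind.holds_least_iff he hτ (two_le_above _) hδ (by simpa using hmem b hb hbt)]
  simp

theorem Tm.noemata_pair (a b : Tm) : (a.pair b).noemata = a.noemata ∪ b.noemata := by
  rw [Tm.pair, Tm.noemata_upair, Tm.noemata_sing, Tm.noemata_upair, ← Finset.union_assoc,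
    Finset.union_self]

theorem Fm.noemata_and (A B : Fm) : (Fm.and A B).noemata = A.noemata ∪ B.noemata := by
  simp [Fm.and, Fm.noemata]

theorem Fm.noemata_imp (A B : Fm) : (Fm.imp A B).noemata = A.noemata ∪ B.noemata := by
  simp [Fm.imp, Fm.noemata]

theorem Fm.noemata_ex (n : ℕ) (A : Fm) : (Fm.ex n A).noemata = A.noemata.erase n := by
  simp [Fm.ex, Fm.neg, Fm.noemata]

theorem Fm.noemata_preceq (a b : Tm) : (Fm.preceq a b).noemata = a.noemata ∪ b.noemata := by
  have hnat : Tm.nat.noemata = ∅ := isCognomen_nat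
  unfold Fm.preceq Fm.prec
  generalize above (a.noemata ∪ b.noemata) = x
  ext n
  simp only [Tm.noemata, Fm.noemata_ex, Fm.noemata_and, Fm.noemata_or, Fm.noemata_eq, Fm.noemata,
    hnat, Tm.noemata_pair, Finset.mem_erase, Finset.mem_union, Finset.mem_singleton,
    Finset.notMem_empty]
  tauto

theorem Fm.noemata_least (a b : Tm) : (Fm.least a b).noemata = a.noemata ∪ b.noemata := by
  unfold Fm.least
  generalize above (a.noemata ∪ b.noemata) = z
  ext n
  simp only [Fm.noemata_and, Fm.noemata_imp, Fm.noemata_preceq, Fm.noemata, Tm.noemata,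
    Finset.mem_erase, Finset.mem_union, Finset.mem_singleton]
  tauto

theorem Tm.noemata_choice_subset (t : Tm) : t.choice.noemata ⊆ t.noemata := by
  unfold Tm.choice
  generalize above t.noemata = x
  intro n
  simp only [Tm.noemata, Fm.noemata_ex, Fm.noemata_and, Fm.noemata_least, Fm.noemata,
    Finset.mem_erase, Finset.mem_union, Finset.mem_singleton]
  tauto

end Order

end Libra

/-! ### The choice theorem -/

open Libra in
theorem mainTheorem9 (e : ℕ → Libra.Tm) (he : Libra.IsEnumeration e) (a : Libra.Tm) :
    let n := Libra.above a.noemata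
    let x := Libra.Tm.v n
    let y := Libra.Tm.v (n + 1)
    let z := Libra.Tm.v (n + 2)
    let w := Libra.Tm.v (n + 3)
    -- if `a` is a kind
    Libra.Maxim e (.kind a) →
    -- and all members of `a` are kinds
    Libra.Maxim e (.all (n + 1) (.imp (.mem y a) (.kind y))) →
    -- then the choice term is a kind,
    Libra.Maxim e (.kind a.choice) ∧
    -- its members are precisely the least elements of the members of `a`,
    Libra.Maxim e (.all n (.iff (.mem x a.choice)
      (.ex (n + 1) (.and (.mem y a) (.least x y))))) ∧
    -- each inhabited member `y` of `a` has precisely one least element, and the choice term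
    -- contains it,
    Libra.Maxim e (.all (n + 1) (.imp (.and (.mem y a) (.ex n (.mem x y)))
      (.ex n (.and (.and (.least x y) (.mem x a.choice))
        (.all (n + 2) (.imp (.least z y) (.eq z x))))))) ∧
    -- and if, moreover, `y` is coextensional with every member `w` of `a` that it meets, then
    -- precisely one member of `y` belongs to the choice term
    Libra.Maxim e (.all (n + 1) (.imp
      (.and (.and (.mem y a) (.ex n (.mem x y)))
        (.all (n + 3) (.imp (.and (.mem w a) (.ex n (.and (.mem x y) (.mem x w))))
          (.all n (.iff (.mem x y) (.mem x w))))))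
      (.ex n (.and (.and (.mem x y) (.mem x a.choice))
        (.all (n + 2) (.imp (.and (.mem z y) (.mem z a.choice)) (.eq z x))))))) := by
  intro n x y z w hkind hkinds
  have hσ := isAssignment_named he
  have h2 : 2 ≤ n := two_le_above _
  have h0 : n ∉ a.noemata := notMem_of_above_le le_rfl
  have h1 : n + 1 ∉ a.noemata := notMem_of_above_le (Nat.le_add_right _ _)
  have h3 : n + 3 ∉ a.noemata := notMem_of_above_le (Nat.le_add_right _ _)
  simp only [maxim_iff he] at *
  rw [forall_holds_kind_iff he hσ] at hkind ⊢
  -- the members of `a` are the same at all relevant stages, and are kinds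
  have hK : ∀ b : Tm, b.IsCognomen →
      Member e (nearAt e (koppa e)) b (a.subst (named e)) → IsKind e b := fun b hb hba => by
    have hτ := hσ.update (n + 1) hb
    have hh : ∀ γ, koppa e ≤ γ → Holds e (nearAt e γ) (.kind y)
        (Function.update (named e) (n + 1) b) := fun γ hγ => by
      have := hkinds γ hγ
      rw [holds_all] at this
      refine holds_imp.1 (this b hb) ?_
      rw [holds_mem, Tm.subst_update h1]
      simpa [y, Tm.subst] using (hkind b hb γ hγ).2 hba
    simpa [y, Tm.subst] using (forall_holds_kind_iff he hτ y).1 hh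
  have hC := fun (c : Tm) (hc : c.IsCognomen) γ (hγ : koppa e ≤ γ) =>
    member_choice he hσ a hkind hK hc hγ
  -- none of the noemata bound in the claims is free in the choice term
  have k0 : n ∉ a.choice.noemata := fun h => h0 (a.noemata_choice_subset h)
  have k1 : n + 1 ∉ a.choice.noemata := fun h => h1 (a.noemata_choice_subset h)
  have k2 : n + 2 ∉ a.choice.noemata := fun h =>
    notMem_of_above_le (Nat.le_add_right _ _) (a.noemata_choice_subset h)
  refine ⟨fun c hc γ hγ => by rw [hC c hc γ hγ, hC c hc _ le_rfl], fun γ hγ => ?_, fun γ hγ => ?_,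
    fun γ hγ => ?_⟩
  · rw [holds_all]
    intro c hc
    simp only [holds_iff, holds_ex, holds_and, holds_mem, Tm.subst_update h0, Tm.subst_update h1,
      Tm.subst_update k0, x, y, Tm.subst, Function.update_self, hC c hc γ hγ]
    refine exists_congr fun b => and_congr_right fun hb => ?_
    rw [hkind b hb γ hγ]
    refine and_congr_right fun hba => ?_
    rw [IsKind.holds_least_iff he ((hσ.update n hc).update (n + 1) hb) h2 hγ
      (by simpa using hK b hb hba)]
    simp
  · rw [holds_all]
    intro b hb
    simp only [holds_imp, holds_ex, holds_and, holds_mem, holds_all, holds_eq,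
      Tm.subst_update h1, Tm.subst_update k0, Tm.subst_update k1, x, y, z, Tm.subst,
      Function.update_self, ne_eq, Nat.add_eq_left, one_ne_zero, not_false_eq_true,
      Function.update_of_ne]
    rintro ⟨hba, c, hc, hcb⟩
    rw [hkind b hb γ hγ] at hba
    rw [hK b hb hba c hc γ hγ] at hcb
    obtain ⟨d, hd, hdb⟩ := exists_isLeastIn hc hcb
    have hτ := (hσ.update (n + 1) hb).update n hd
    refine ⟨d, hd, ⟨?_, (hC d hd γ hγ).2 ⟨b, hb, hba, hdb⟩⟩, fun c hc h => ?_⟩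
    · rw [IsKind.holds_least_iff he hτ h2 hγ (by simpa using hK b hb hba)]
      simpa using hdb
    · rw [IsKind.holds_least_iff he (hτ.update (n + 2) hc) (Nat.le_add_left 2 n) hγ
        (by simpa using hK b hb hba)] at h
      have h' : IsLeastIn e c b := by simpa using h
      simpa [ident_iff_same he hc hd hγ] using h'.same he hc hd hdb
  · rw [holds_all]
    intro b hb
    simp only [holds_imp, holds_iff, holds_ex, holds_and, holds_mem, holds_all, holds_eq,
      Tm.subst_update h1, Tm.subst_update h3,
      Tm.subst_update k0, Tm.subst_update k1, Tm.subst_update k2, x, y, z, w, Tm.subst,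
      Function.update_self, ne_eq, Nat.add_eq_left, one_ne_zero,
      not_false_eq_true, Function.update_of_ne]
    rintro ⟨⟨hba, c, hc, hcb⟩, hco⟩
    rw [hkind b hb γ hγ] at hba
    have hbK := hK b hb hba
    rw [hbK c hc γ hγ] at hcb
    obtain ⟨d, hd, hdb⟩ := exists_isLeastIn hc hcb
    have hdγ := (hbK d hd γ hγ).2 hdb.1
    refine ⟨d, hd, ⟨by simpa using hdγ, (hC d hd γ hγ).2 ⟨b, hb, hba, hdb⟩⟩, fun c hc h => ?_⟩
    have hcb : Member e (nearAt e γ) c b := by simpa using h.1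
    obtain ⟨w, hw, hwa, hcw⟩ := (hC c hc γ hγ).1 h.2
    have hwK := hK w hw hwa
    -- `c` is least in a member `w` of `a` that is coextensional with `b`, hence least in `b`
    have hext : ∀ c : Tm, c.IsCognomen → (Member e (nearAt e (koppa e)) c b ↔
        Member e (nearAt e (koppa e)) c w) := fun x hx => by
      rw [← hbK x hx γ hγ, ← hwK x hx γ hγ]
      simpa using hco w hw ⟨(hkind w hw γ hγ).2 hwa, c, hc, by simpa using hcb,
        by simpa using (hwK c hc γ hγ).2 hcw.1⟩ x hx
    have hcb' : IsLeastIn e c b :=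
      ⟨(hext c hc).2 hcw.1, fun x hx h => hcw.2 x hx ((hext x hx).1 h)⟩
    simpa [ident_iff_same he hc hd hγ] using hcb'.same he hc hd hdb
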